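/- An election is a pair $(C,V)$ of a finite set $C$ of candidates and a finite list $V$ of voters' ballots over $C$; an election system maps it to a (possibly empty) set of winners $W\subseteq C$. For plurality, Copeland$^\alpha$ and Condorcet a ballot is a preference list (a strict linear order on $C$); for approval it is a $0$-$1$ vector indexed by $C$. Let $N(c,c')$ be the number of voters who prefer $c$ to $c'$. In plurality a candidate gets one point for each voter ranking it first, in approval one point for each voter approving of it, in Copeland$^\alpha$ one point for each $c'\in C\setminus\{c\}$ with $N(c,c')>N(c',c)$ and $\alpha$ points for each $c'\in C\setminus\{c\}$ with $N(c,c')=N(c',c)$; in these systems the candidates with the highest score win. In Condorcet, $c$ wins iff $N(c,c')>N(c',c)$ for all $c'\in C\setminus\{c\}$. Candidate $p$ is a unique winner if the set of winners is $\{p\}$. When only some candidates take part, ballots are restricted to these. In the constructive (destructive) AC+DC+AV+DV+BV control problem for an election system $\mathcal E$ one is given disjoint candidate sets $C$ and $A$, two disjoint collections $V$ and $W$ of voters with ballots over $C\cup A$, a candidate $p\in C$, and nonnegative integers $k_{\rm AC},k_{\rm DC},k_{\rm AV},k_{\rm DV},k_{\rm BV}$. The question is whether there are $A'\subseteq A$,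 $C'\subseteq C\setminus\{p\}$, $W'\subseteq W$, $V'\subseteq V$ with $|A'|\le k_{\rm AC}$, $|C'|\le k_{\rm DC}$, $|W'|\le k_{\rm AV}$, $|V'|\le k_{\rm DV}$ such that, by changing the ballots of at most $k_{\rm BV}$ voters of $(V\setminus V')\cup W'$, one can ensure that $p$ is (is not) a unique winner of the $\mathcal E$ election $((C\setminus C')\cup A',(V\setminus V')\cup W')$. For a subset $T$ of the five prongs AC, DC, AV, DV, BV, the $T$ control problem is the special case in which the limits $k$ of all other prongs are $0$, with $A=\emptyset$ if AC $\notin T$ and $W=\emptyset$ if AV $\notin T$. The system $\mathcal E$ is susceptible to constructive (destructive) $T$ control if in some instance of the problem $p$ is not (is) a unique winner of $(C,V)$ but a legal control action ensures that $p$ is (is not) a unique winner. It is vulnerable to constructive (destructive) $T$ control if it is susceptible to it and the constructive (destructive) $T$ control problem is decided by a polynomial-time algorithm. Theorem. (a) Plurality is vulnerable to both constructive AV+DV+BV control and destructive AV+DV+BV control. (b) Both Condorcet and approval are vulnerable to destructive AC+AV+DV+BV control. (c) For each rational $\alpha$ with $0\le\alpha\le1$, Copeland$^\alpha$ is vulnerable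 to destructive AC+DC control. -/

import Mathlib

/-! ## A machine model with a step count: structured random access machines -/

namespace RAM

/-- Programs of a random access machine. Scalars `x y z : ℕ` name program variables; besides
them there is an unbounded memory array that is accessed by `load` and `store`. The only
arithmetic is addition and truncated subtraction, so that a run of `t` steps creates numbers
with at most `t` bits more than the input has, and a Turing machine simulates it with
polynomial overhead. -/
inductive Prog : Type
  | skip : Prog
  | const (x n : ℕ) : Prog
  | copy (x y : ℕ) : Prog
  | add (x y z : ℕ) : Prog
  | sub (x y z : ℕ) : Prog
  | load (x y : ℕ) : Prog
  | store (x y : ℕ) : Prog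
  | seq (P Q : Prog) : Prog
  | ite (x : ℕ) (P Q : Prog) : Prog
  | while (x : ℕ) (P : Prog) : Prog

/-- A machine state: the values of the program variables and the contents of the memory. -/
structure State where
  reg : ℕ → ℕ
  mem : ℕ → ℕ

/-- Assign the value `n` to the variable `x`. -/
def State.set (s : State) (x n : ℕ) : State := { s with reg := Function.update s.reg x n }

/-- Write the value `n` to the memory cell with address `a`. -/
def State.write (s : State) (a n : ℕ) : State := { s with mem := Function.update s.mem a n }

/-- `Exec P s s' t`: started in the state `s`, the program `P` halts in the state `s'` after
exactly `t` steps. Every elementary instruction and every evaluation of a test is one step;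
a test on `x` succeeds iff the variable `x` is nonzero. -/
inductive Exec : Prog → State → State → ℕ → Prop
  | skip (s) : Exec .skip s s 1
  | const (x n s) : Exec (.const x n) s (s.set x n) 1
  | copy (x y s) : Exec (.copy x y) s (s.set x (s.reg y)) 1
  | add (x y z s) : Exec (.add x y z) s (s.set x (s.reg y + s.reg z)) 1
  | sub (x y z s) : Exec (.sub x y z) s (s.set x (s.reg y - s.reg z)) 1
  | load (x y s) : Exec (.load x y) s (s.set x (s.mem (s.reg y))) 1
  | store (x y s) : Exec (.store x y) s (s.write (s.reg x) (s.reg y)) 1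
  | seq {P Q s s' s'' t t'} : Exec P s s' t → Exec Q s' s'' t' → Exec (.seq P Q) s s'' (t + t')
  | ite_true {x P Q s s' t} : s.reg x ≠ 0 → Exec P s s' t → Exec (.ite x P Q) s s' (t + 1)
  | ite_false {x P Q s s' t} : s.reg x = 0 → Exec Q s s' t → Exec (.ite x P Q) s s' (t + 1)
  | while_true {x P s s' s'' t t'} : s.reg x ≠ 0 → Exec P s s' t →
      Exec (.while x P) s' s'' t' → Exec (.while x P) s s'' (t + t' + 1)
  | while_false {x P s} : s.reg x = 0 → Exec (.while x P) s s 1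

/-- The machine is deterministic: the final state and the number of steps are unique. -/
theorem Exec.unique {P : Prog} {s s₁ s₂ : State} {t₁ t₂ : ℕ}
    (h₁ : Exec P s s₁ t₁) (h₂ : Exec P s s₂ t₂) : s₁ = s₂ ∧ t₁ = t₂ := by
  induction h₁ generalizing s₂ t₂ with
  | skip | const | copy | add | sub | load | store => cases h₂; exact ⟨rfl, rfl⟩
  | seq _ _ ih ih' =>
    cases h₂ with
    | seq a b => obtain ⟨rfl, rfl⟩ := ih a; obtain ⟨rfl, rfl⟩ := ih' b; exact ⟨rfl, rfl⟩
  | ite_true hx _ ih =>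
    cases h₂ with
    | ite_true _ a => obtain ⟨rfl, rfl⟩ := ih a; exact ⟨rfl, rfl⟩
    | ite_false h => exact absurd h hx
  | ite_false hx _ ih =>
    cases h₂ with
    | ite_true h => exact absurd hx h
    | ite_false _ a => obtain ⟨rfl, rfl⟩ := ih a; exact ⟨rfl, rfl⟩
  | while_true hx _ _ ih ih' =>
    cases h₂ with
    | while_true _ a b => obtain ⟨rfl, rfl⟩ := ih a; obtain ⟨rfl, rfl⟩ := ih' b; exact ⟨rfl, rfl⟩
    | while_false h => exact absurd h hx
  | while_false hx =>
    cases h₂ with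
    | while_true h => exact absurd hx h
    | while_false _ => exact ⟨rfl, rfl⟩

/-- The initial state on an input sequence: the sequence stands in the memory cells
`0, 1, 2, …`, its length in variable `0`, and everything else is `0`. -/
def initial (input : List ℕ) : State where
  reg := Function.update (fun _ => 0) 0 input.length
  mem := fun i => input.getD i 0

/-- The size of an input sequence: the total length of the binary representations of its
entries, plus one separator for each entry. -/
def inputSize (input : List ℕ) : ℕ := (input.map fun n => Nat.size n + 1).sum

/-- The decision problem with instances `α`, encoded by `code`, and set of yes-instances `L` is
decided by a polynomial-time algorithm. A halting run accepts iff variable `0` is nonzero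
at the end. -/
def DecidableInPolyTime {α : Type} (code : α → List ℕ) (L : Set α) : Prop :=
  ∃ (P : Prog) (q : Polynomial ℕ), ∀ I : α, ∃ (s : State) (t : ℕ),
    Exec P (initial (code I)) s t ∧ t ≤ q.eval (inputSize (code I)) ∧ (s.reg 0 ≠ 0 ↔ I ∈ L)

end RAM

/-! ## Elections; candidates are named by natural numbers -/

namespace Voting

/-- A kind of ballots. `IsOver b C` says that `b` is a ballot over the candidate set `C`,
`restrict b S` is the ballot that `b` induces on `S ⊆ C`, and `code cs b` is the encoding of
a ballot `b` over the candidates listed in `cs`. -/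
class BallotKind (B : Type) where
  IsOver : B → Finset ℕ → Prop
  restrict : B → Finset ℕ → B
  code : List ℕ → B → List ℕ

/-- A preference list, from the most preferred candidate to the least preferred one. -/
abbrev PrefList : Type := List ℕ

instance : BallotKind PrefList where
  IsOver v C := v.Nodup ∧ v.toFinset = C
  restrict v S := v.filter fun c => c ∈ S
  code _ v := v

/-- An approval ballot, a 0-1 vector indexed by the candidates, given as the set of the
candidates with entry `1`. -/
abbrev ApprovalBallot : Type := Finset ℕ

instance : BallotKind ApprovalBallot where
  IsOver b C := b ⊆ C
  restrict b S := b ∩ S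
  code cs b := cs.map fun c => if c ∈ b then 1 else 0

/-- An election system maps an election, that is, a candidate set `C` and a list of ballots
over `C`, to a possibly empty set of winners. -/
structure ElectionSystem (B : Type) where
  winners : Finset ℕ → List B → Finset ℕ
  winners_subset : ∀ C V, winners C V ⊆ C

/-- The system that elects the candidates with the highest score. -/
def ElectionSystem.ofScore {B : Type} (score : Finset ℕ → List B → ℕ → ℚ) :
    ElectionSystem B where
  winners C V := C.filter fun c => ∀ c' ∈ C, score C V c' ≤ score C V c
  winners_subset _ _ := Finset.filter_subset _ _

/-- `prefers V c c'` is the number of voters in `V` that prefer `c` to `c'`. -/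
def prefers (V : List PrefList) (c c' : ℕ) : ℕ := V.countP fun v => v.idxOf c < v.idxOf c'

/-- Plurality: one point from each voter who ranks the candidate first. -/
def plurality : ElectionSystem PrefList :=
  .ofScore fun _ V c => (V.countP fun v => v.head? = some c : ℕ)

/-- Approval: one point from each voter who approves of the candidate. -/
def approval : ElectionSystem ApprovalBallot :=
  .ofScore fun _ V c => (V.countP fun b => c ∈ b : ℕ)

/-- Copeland with tie value `α`: one point for each won and `α` points for each tied
head-to-head contest. -/
def copeland (α : ℚ) : ElectionSystem PrefList :=
  .ofScore fun C V c => ∑ c' ∈ C.erase c,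
    if prefers V c' c < prefers V c c' then 1
    else if prefers V c c' = prefers V c' c then α
    else 0

/-- The system that elects the Condorcet winner if there is one, and nobody otherwise. -/
def condorcet : ElectionSystem PrefList where
  winners C V := C.filter fun c => ∀ c' ∈ C, c' ≠ c → prefers V c' c < prefers V c c'
  winners_subset _ _ := Finset.filter_subset _ _

/-- `c` is a unique winner of the election with candidate set `S` and voters `U`, whose ballots
may rank further candidates too and are restricted to `S`. -/
def IsUniqueWinner {B : Type} [BallotKind B] (E : ElectionSystem B) (S : Finset ℕ) (U : List B)
    (c : ℕ) : Prop :=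
  E.winners S (U.map fun b => BallotKind.restrict b S) = {c}

/-! ## Multiprong control -/

/-- The basic prongs: adding candidates, deleting candidates, adding voters, deleting voters,
bribing voters. -/
inductive Prong : Type
  | AC | DC | AV | DV | BV

/-- The goal of the attacker. -/
inductive Goal : Type
  | constructive | destructive

/-- An instance of the control problem, with qualified candidates `C`, spoiler candidates `A`,
registered voters `V`, unregistered voters `W`, the preferred or despised candidate `p`, and
the five limits. -/
structure ControlInstance (B : Type) [BallotKind B] where
  C : List ℕ
  A : List ℕ
  V : List B
  W : List B
  p : ℕ
  kAC : ℕ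
  kDC : ℕ
  kAV : ℕ
  kDV : ℕ
  kBV : ℕ
  nodup_C : C.Nodup
  nodup_A : A.Nodup
  disjoint : C.Disjoint A
  ballots_V : ∀ b ∈ V, BallotKind.IsOver b (C.toFinset ∪ A.toFinset)
  ballots_W : ∀ b ∈ W, BallotKind.IsOver b (C.toFinset ∪ A.toFinset)
  p_mem : p ∈ C

namespace ControlInstance

variable {B : Type} [BallotKind B]

/-- `I` is an instance of the variant with the prongs in `T`: parts that belong to other
prongs are missing, i.e. empty or zero. -/
def OfType (I : ControlInstance B) (T : Set Prong) : Prop :=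
  (Prong.AC ∉ T → I.A = [] ∧ I.kAC = 0) ∧ (Prong.DC ∉ T → I.kDC = 0) ∧
  (Prong.AV ∉ T → I.W = [] ∧ I.kAV = 0) ∧ (Prong.DV ∉ T → I.kDV = 0) ∧
  (Prong.BV ∉ T → I.kBV = 0)

/-- The encoding of an instance as a sequence of natural numbers. Each ballot is encoded by
`|C| + |A|` numbers. -/
def code (I : ControlInstance B) : List ℕ :=
  [I.C.length, I.A.length, I.V.length, I.W.length, I.p, I.kAC, I.kDC, I.kAV, I.kDV, I.kBV] ++
    I.C ++ I.A ++ I.V.flatMap (BallotKind.code (I.C ++ I.A)) ++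
    I.W.flatMap (BallotKind.code (I.C ++ I.A))

/-- `I.CanReach S U`: a legal control action leads to the candidate set `S` and the voters `U`.
The candidates in `C'` are deleted and those in `A'` are added; `V₀` lists the voters of `V`
that are not deleted and `W'` the added ones; then at most `kBV` of the resulting voters
change their ballots. -/
def CanReach [DecidableEq B] (I : ControlInstance B) (S : Finset ℕ) (U : List B) : Prop :=
  ∃ (A' C' : Finset ℕ) (V₀ W' : List B),
    A' ⊆ I.A.toFinset ∧ A'.card ≤ I.kAC ∧
    C' ⊆ I.C.toFinset ∧ I.p ∉ C' ∧ C'.card ≤ I.kDC ∧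
    V₀.Sublist I.V ∧ I.V.length ≤ V₀.length + I.kDV ∧
    W'.Sublist I.W ∧ W'.length ≤ I.kAV ∧
    S = (I.C.toFinset \ C') ∪ A' ∧
    U.length = (V₀ ++ W').length ∧
    ((V₀ ++ W').zip U).countP (fun x => x.1 ≠ x.2) ≤ I.kBV ∧
    ∀ b ∈ U, BallotKind.IsOver b (I.C.toFinset ∪ I.A.toFinset)

end ControlInstance

variable {B : Type} [BallotKind B]

/-- The goal with respect to `p` is met in the given election (unique-winner model). -/
def GoalMet (E : ElectionSystem B) (S : Finset ℕ) (U : List B) (p : ℕ) : Goal → Prop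
  | .constructive => IsUniqueWinner E S U p
  | .destructive => ¬ IsUniqueWinner E S U p

/-- `I` is a yes-instance: some legal control action leads to an election that meets the goal. -/
def Controllable [DecidableEq B] (E : ElectionSystem B) (g : Goal) (I : ControlInstance B) :
    Prop :=
  ∃ S U, I.CanReach S U ∧ GoalMet E S U I.p g

/-- Some control action with the prongs in `T` makes some candidate become (stop being) a
unique winner. -/
def Susceptible [DecidableEq B] (E : ElectionSystem B) (g : Goal) (T : Set Prong) : Prop :=
  ∃ I : ControlInstance B, I.OfType T ∧ ¬ GoalMet E I.C.toFinset I.V I.p g ∧ Controllable E g I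

/-- `E` is vulnerable to control with goal `g` and prongs `T`: it is susceptible, and the control
problem is decided by a polynomial-time algorithm. -/
def Vulnerable [DecidableEq B] (E : ElectionSystem B) (g : Goal) (T : Set Prong) : Prop :=
  Susceptible E g T ∧
    RAM.DecidableInPolyTime (α := {I : ControlInstance B // I.OfType T})
      (fun I => I.1.code) {I | Controllable E g I.1}

end Voting

/-! Each control problem reduces to an arithmetic criterion that compares counts of voters or sums
of such comparisons, and each criterion is the value of a fixed expression. A sum in an expression
runs at most as often as the input is long, so the compiled program takes polynomial time
(`Expr.computes_compile`, `decidableInPolyTime_of_expr`). Susceptibility is witnessed by instances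
with two candidates and at most one voter.

Destructive control of Condorcet, approval and plurality: give every candidate a rank in each ballot
(its position; or 0/1 for disapproval; or 0/1 for not being first). Then `p` fails to be the unique
winner iff some rival `c` is ahead of `p` in at least as many ballots as `p` is ahead of `c`. This
concerns one rival at a time. A deleted voter closes the gap by at most one, an added voter by at
most one and only if `c` is ahead there, a bribed voter by at most two. The greedy attack attains
all these bounds at once (`controllable_destructive_iff`).

Constructive control of plurality: let `T` be the number of first places of `p` after adding as many
supporters of `p` as allowed and bribing as many registered non-supporters as possible. Every rival
has to be pushed down to `T - 1`. One bribe or deletion removes at most one unit of the total excess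
over `T - 1`, and one unit per action is attainable, so the test is whether the bribes and deletions
cover the excess. The case `T = 0` and the lone candidate are treated apart
(`controllable_plurality_constructive_iff`).

Destructive control of Copeland: multiplying the scores by the denominator of `α` makes them natural
numbers. For a fixed rival `c`, a third candidate `d` contributes to the gap between `c` and `p`
independently of all others, so it is best to delete the candidates most favourable to `p` and to
add those most favourable to `c`. The criterion contains the sums of the largest gains
(`controllable_copeland_iff`), and ranking by counting computes these without sorting. -/

/-! ## An expression language that compiles to the machine -/

namespace RAM

/-- Expressions over named variables and a read-only memory. The variable bound by `sum` runs
below the value of the bound, capped at the length of the input. -/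
inductive Expr : Type
  | var (x : ℕ) : Expr
  | const (n : ℕ) : Expr
  | cell (e : Expr) : Expr
  | add (a b : Expr) : Expr
  | sub (a b : Expr) : Expr
  | ite (a b c : Expr) : Expr
  | bind (x : ℕ) (a b : Expr) : Expr
  | sum (x : ℕ) (n b : Expr) : Expr

namespace Expr

/-- The value of an expression, with memory `M` and loop cap `L`. -/
def eval (M : ℕ → ℕ) (L : ℕ) : Expr → (ℕ → ℕ) → ℕ
  | var x, env => env x
  | const n, _ => n
  | cell e, env => M (e.eval M L env)
  | add a b, env => a.eval M L env + b.eval M L env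
  | sub a b, env => a.eval M L env - b.eval M L env
  | ite a b c, env => if a.eval M L env ≠ 0 then b.eval M L env else c.eval M L env
  | bind x a b, env => b.eval M L (Function.update env x (a.eval M L env))
  | sum x n b, env =>
    ∑ i ∈ Finset.range (min (n.eval M L env) L), b.eval M L (Function.update env x i)

/-- A strict upper bound on the variable names in an expression. -/
def fresh : Expr → ℕ
  | var x => x + 1
  | const _ => 0
  | cell e => e.fresh
  | add a b => max a.fresh b.fresh
  | sub a b => max a.fresh b.fresh
  | ite a b c => max a.fresh (max b.fresh c.fresh)
  | bind x a b => max (x + 1) (max a.fresh b.fresh)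
  | sum x n b => max (x + 1) (max n.fresh b.fresh)

/-- The body of the loop that evaluates a sum over `x`, with `B` the code of the summand. -/
def loopBody (x d : ℕ) (B : Prog) : Prog :=
  .seq B (.seq (.add (d + 2) (d + 2) (d + 4)) (.seq (.add (x + 1) (x + 1) (d + 3))
    (.sub (d + 1) (d + 1) (d + 3))))

/-- Code that evaluates an expression into the register `d` and leaves the registers below `d`
as they were; the variable `x` is held in the register `x + 1`. -/
def compile : Expr → ℕ → Prog
  | var x, d => .copy d (x + 1)
  | const n, d => .const d n
  | cell e, d => .seq (e.compile d) (.load d d)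
  | add a b, d => .seq (a.compile d) (.seq (b.compile (d + 1)) (.add d d (d + 1)))
  | sub a b, d => .seq (a.compile d) (.seq (b.compile (d + 1)) (.sub d d (d + 1)))
  | ite a b c, d => .seq (a.compile d) (.ite d (b.compile d) (c.compile d))
  | bind x a b, d => .seq (a.compile (d + 1)) (.seq (.copy d (x + 1))
      (.seq (.copy (x + 1) (d + 1)) (.seq (b.compile (d + 1))
        (.seq (.copy (x + 1) d) (.copy d (d + 1))))))
  | sum x n b, d => .seq (n.compile (d + 1)) (.seq (.copy d (x + 1))
      (.seq (.sub (d + 2) (d + 1) 0) (.seq (.sub (d + 1) (d + 1) (d + 2))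
        (.seq (.const (d + 2) 0) (.seq (.const (x + 1) 0) (.seq (.const (d + 3) 1)
          (.seq (.while (d + 1) (loopBody x d (b.compile (d + 4))))
            (.seq (.copy (x + 1) d) (.copy d (d + 2))))))))))

/-- A bound on the running time of the code of an expression. -/
noncomputable def time : Expr → Polynomial ℕ
  | var _ => 1
  | const _ => 1
  | cell e => e.time + 1
  | add a b => a.time + b.time + 1
  | sub a b => a.time + b.time + 1
  | ite a b c => a.time + b.time + c.time + 1
  | bind _ a b => a.time + b.time + 4
  | sum _ n b => n.time + .X * (b.time + 4) + 9

/-- The registers hold the variables named below `K`. -/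
def Holds (K : ℕ) (s : State) (env : ℕ → ℕ) : Prop := ∀ x < K, s.reg (x + 1) = env x

/-- `P` computes the value `v` into the register `d` within `t` steps, and changes neither the
memory nor the registers below `d`. -/
def Computes (P : Prog) (s : State) (d v t : ℕ) : Prop :=
  ∃ s' t', Exec P s s' t' ∧ t' ≤ t ∧ s'.reg d = v ∧ s'.mem = s.mem ∧ ∀ r < d, s'.reg r = s.reg r

theorem Holds.congr {K : ℕ} {s s' : State} {env : ℕ → ℕ} (h : Holds K s env) {d : ℕ} (hd : K < d)
    (hr : ∀ r < d, s'.reg r = s.reg r) : Holds K s' env := fun x hx => by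
  rw [hr _ (by omega), h x hx]

/-- Induction on the number `n` of rounds left, which register `d + 1` holds; `x + 1` holds the
index, `d + 2` the partial sum and `d + 3` the constant one. A round costs the summand, three
updates and a test; the last `+ 1` is the failing test. -/
theorem exec_loop {K x d T : ℕ} {M env : ℕ → ℕ} {L : ℕ} {B : Prog} {f : (ℕ → ℕ) → ℕ}
    (hx : x < K) (hd : K < d)
    (hB : ∀ s env, Holds K s env → s.mem = M → s.reg 0 = L → Computes B s (d + 4) (f env) T)
    (n : ℕ) : ∀ (i a : ℕ) (s : State), Holds K s (Function.update env x i) → s.mem = M →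
      s.reg 0 = L → s.reg (d + 1) = n → s.reg (d + 2) = a → s.reg (d + 3) = 1 →
      ∃ s' t, Exec (.while (d + 1) (loopBody x d B)) s s' t ∧ t ≤ n * (T + 4) + 1 ∧
        s'.reg (d + 2) = a + ∑ j ∈ Finset.range n, f (Function.update env x (i + j)) ∧
        s'.mem = s.mem ∧ ∀ r ≤ d, r ≠ x + 1 → s'.reg r = s.reg r := by
  induction n with
  | zero =>
    intro i a s _ _ _ h1 h2 _
    exact ⟨s, 1, .while_false h1, by omega, by simp [h2], rfl, fun _ _ _ => rfl⟩
  | succ n ih =>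
    intro i a s hs hM hL h1 h2 h3
    obtain ⟨s₁, t₁, e₁, ht₁, hv, hm, hr⟩ := hB s _ hs hM hL
    have E : Exec (loopBody x d B) s (((s₁.set (d + 2) (a + f (Function.update env x i))).set
        (x + 1) (i + 1)).set (d + 1) n) (t₁ + (1 + (1 + 1))) := by
      have hxi : s.reg (x + 1) = i := by simpa using hs x hx
      convert (Exec.seq e₁ (.seq (.add _ _ _ _) (.seq (.add _ _ _ _) (.sub _ _ _ _))) :
        Exec (loopBody x d B) s _ _) using 1
      · rfl
      simp [State.set, Function.update, hv, hr (d + 2) (by omega), hr (d + 1) (by omega),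
        hr (d + 3) (by omega), hr (x + 1) (by omega), h1, h2, h3, hxi,
        show ¬ d + 2 = x by omega, show ¬ d = x by omega, show ¬ x = d + 1 by omega]
    obtain ⟨s₃, t₃, e₃, ht₃, hv₃, hm₃, hr₃⟩ := ih (i + 1) (a + f (Function.update env x i))
      (((s₁.set (d + 2) (a + f (Function.update env x i))).set (x + 1) (i + 1)).set (d + 1) n)
      (by
        intro y hy
        have := hs y hy
        by_cases hxy : y = x
        · subst hxy
          simp [State.set, Function.update, show ¬ y = d by omega]
        · simp only [ne_eq, hxy, not_false_eq_true, Function.update_of_ne] at this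
          simp [State.set, Function.update, hxy, show ¬ y = d by omega,
            show ¬ y = d + 1 by omega, hr (y + 1) (by omega), this])
      (by simp [State.set, hm, hM])
      (by simp [State.set, Function.update, hr 0 (by omega), hL])
      (by simp [State.set])
      (by simp [State.set, Function.update, show ¬ d + 1 = x by omega])
      (by simp [State.set, Function.update, show ¬ d + 2 = x by omega, hr (d + 3) (by omega), h3])
    refine ⟨s₃, _, .while_true (by omega) E e₃, ?_, ?_, ?_, ?_⟩
    · have : (n + 1) * (T + 4) = n * (T + 4) + (T + 4) := by ring
      omega
    · rw [hv₃, Finset.sum_range_succ']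
      simp only [add_assoc, add_zero, add_comm 1]
      ring
    · simp [hm₃, State.set, hm]
    · intro r hr1 hr2
      rw [hr₃ r hr1 hr2]
      simp [State.set, Function.update, hr2, show ¬ r = d + 1 by omega, show ¬ r = d + 2 by omega,
        hr r (by omega)]

/-- Register `0` keeps the input length and the registers up to `K` keep the variables; scratch
space starts at `d > K`. The only lower register ever overwritten is that of a bound variable, which
is restored from a copy saved in `d`. Hence intermediate results survive and structural induction
applies. -/
theorem computes_compile (e : Expr) {K : ℕ} (hK : e.fresh ≤ K) : ∀ {d : ℕ}, K < d →
    ∀ (s : State) (env : ℕ → ℕ), Holds K s env →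
      Computes (e.compile d) s d (e.eval s.mem (s.reg 0) env) (e.time.eval (s.reg 0)) := by
  induction e with
  | var x =>
    intro d hd s env h
    refine ⟨_, _, .copy _ _ _, by simp [time], ?_, rfl, ?_⟩
    · simp only [fresh] at hK
      simp [State.set, eval, h x (by omega)]
    · intro r hr
      simp [State.set, Function.update, hr.ne]
  | const n =>
    intro d hd s env h
    refine ⟨_, _, .const _ _ _, by simp [time], by simp [State.set, eval], rfl, ?_⟩
    intro r hr
    simp [State.set, Function.update, hr.ne]
  | cell e ih =>
    intro d hd s env h
    obtain ⟨s₁, t₁, e₁, ht, hv, hm, hr⟩ := ih hK hd s env h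
    refine ⟨_, _, .seq e₁ (.load _ _ _), by simp [time]; omega, ?_, by simp [State.set, hm], ?_⟩
    · simp [State.set, eval, hv, hm]
    · intro r h
      simp [State.set, Function.update, h.ne, hr r h]
  | add a b iha ihb | sub a b iha ihb =>
    intro d hd s env h
    simp only [fresh, sup_le_iff] at hK
    obtain ⟨s₁, t₁, e₁, ht, hv, hm, hr⟩ := iha hK.1 hd s env h
    obtain ⟨s₂, t₂, e₂, ht₂, hv₂, hm₂, hr₂⟩ :=
      ihb hK.2 (Nat.lt_succ_of_lt hd) s₁ env (h.congr hd hr)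
    rw [hm, hr 0 (by omega)] at hv₂
    rw [hr 0 (by omega)] at ht₂
    first
    | refine ⟨_, _, .seq e₁ (.seq e₂ (.add _ _ _ _)), by simp [time]; omega, ?_,
        by simp [State.set, hm₂, hm], ?_⟩
    | refine ⟨_, _, .seq e₁ (.seq e₂ (.sub _ _ _ _)), by simp [time]; omega, ?_,
        by simp [State.set, hm₂, hm], ?_⟩
    · simp [State.set, eval, hv₂, hr₂ d (by omega), hv]
    · intro r h
      simp [State.set, Function.update, h.ne, hr₂ r (by omega), hr r h]
  | ite a b c iha ihb ihc =>
    intro d hd s env h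
    simp only [fresh, sup_le_iff] at hK
    obtain ⟨s₁, t₁, e₁, ht, hv, hm, hr⟩ := iha hK.1 hd s env h
    by_cases hc : s₁.reg d = 0
    · obtain ⟨s₂, t₂, e₂, ht₂, hv₂, hm₂, hr₂⟩ := ihc hK.2.2 hd s₁ env (h.congr hd hr)
      rw [hm, hr 0 (by omega)] at hv₂
      rw [hr 0 (by omega)] at ht₂
      refine ⟨_, _, .seq e₁ (.ite_false hc e₂), by simp [time]; omega, ?_, hm₂.trans hm,
        fun r h => (hr₂ r h).trans (hr r h)⟩
      rw [hv] at hc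
      simp [eval, hv₂, hc]
    · obtain ⟨s₂, t₂, e₂, ht₂, hv₂, hm₂, hr₂⟩ := ihb hK.2.1 hd s₁ env (h.congr hd hr)
      rw [hm, hr 0 (by omega)] at hv₂
      rw [hr 0 (by omega)] at ht₂
      refine ⟨_, _, .seq e₁ (.ite_true hc e₂), by simp [time]; omega, ?_, hm₂.trans hm,
        fun r h => (hr₂ r h).trans (hr r h)⟩
      rw [hv] at hc
      simp [eval, hv₂, hc]
  | bind x a b iha ihb =>
    intro d hd s env h
    simp only [fresh, sup_le_iff] at hK
    have hx : x < K := hK.1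
    obtain ⟨s₁, t₁, e₁, ht, hv, hm, hr⟩ := iha hK.2.1 (Nat.lt_succ_of_lt hd) s env h
    -- The state in which the body starts: the old value of `x` is parked in `d`, and `x` has
    -- received the value computed into `d + 1`.
    set s₂ := (s₁.set d (s.reg (x + 1))).set (x + 1) (a.eval s.mem (s.reg 0) env) with hs₂
    have h₂ : Holds K s₂ (Function.update env x (a.eval s.mem (s.reg 0) env)) := by
      intro y hy
      by_cases hxy : y = x
      · simp [hs₂, State.set, hxy]
      · simp [hs₂, State.set, Function.update, hxy, show ¬ y + 1 = d by omega, hr _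
          (show y + 1 < d + 1 by omega), h y hy]
    obtain ⟨s₃, t₃, e₃, ht₃, hv₃, hm₃, hr₃⟩ := ihb hK.2.2 (Nat.lt_succ_of_lt hd) s₂ _ h₂
    have hm₂ : s₂.mem = s.mem := by simp [hs₂, State.set, hm]
    have h0 : s₂.reg 0 = s.reg 0 := by
      simp [hs₂, State.set, Function.update, hr 0 (by omega), show ¬ 0 = d by omega]
    rw [hm₂, h0] at hv₃
    rw [h0] at ht₃
    have E : Exec ((bind x a b).compile d) s ((s₃.set (x + 1) (s₃.reg d)).set d
        ((s₃.set (x + 1) (s₃.reg d)).reg (d + 1))) (t₁ + (1 + (1 + (t₃ + (1 + 1))))) := by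
      refine .seq e₁ (.seq (.copy _ _ _) (.seq (.copy _ _ _) (.seq (s' := s₃) (t := t₃) ?_
        (.seq (.copy _ _ _) (.copy _ _ _)))))
      convert e₃ using 1
      simp [hs₂, State.set, Function.update, hv, hr (x + 1) (by omega)]
    refine ⟨_, _, E, by simp [time]; omega, ?_, by simp [State.set, hm₃, hm₂], ?_⟩
    · simp [State.set, eval, Function.update, hv₃, show ¬ d = x by omega]
    · intro r hrd
      by_cases hrx : r = x + 1
      · subst hrx
        simp [State.set, Function.update, hrd.ne, hr₃ d (by omega), hs₂,
          show ¬ d = x + 1 by omega]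
      · simp [State.set, Function.update, hrd.ne, hrx, hr₃ r (by omega), hs₂, hr r (by omega)]
  | sum x n b ihn ihb =>
    intro d hd s env h
    simp only [fresh, sup_le_iff] at hK
    have hx : x < K := hK.1
    obtain ⟨s₁, t₁, e₁, ht, hv, hm, hr⟩ := ihn hK.2.1 (Nat.lt_succ_of_lt hd) s env h
    set s₂ := (((s₁.set d (s.reg (x + 1))).set (d + 1)
      (min (n.eval s.mem (s.reg 0) env) (s.reg 0))).set (d + 2) 0 |>.set (x + 1) 0).set (d + 3) 1
      with hs₂
    have h₂ : Holds K s₂ (Function.update env x 0) := by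
      intro y hy
      by_cases hxy : y = x
      · simp [hs₂, State.set, Function.update, hxy, show ¬ x = d + 2 by omega]
      · simp [hs₂, State.set, Function.update, hxy, show ¬ y + 1 = d by omega, hr _
          (show y + 1 < d + 1 by omega), h y hy, show ¬ y = d + 2 by omega,
          show ¬ y = d + 1 by omega, show ¬ y = d by omega]
    have hm₂ : s₂.mem = s.mem := by simp [hs₂, State.set, hm]
    have h0 : s₂.reg 0 = s.reg 0 := by
      simp [hs₂, State.set, Function.update, hr 0 (by omega), show ¬ 0 = d by omega]
    obtain ⟨s₃, t₃, e₃, ht₃, hv₃, hm₃, hr₃⟩ := exec_loop (K := K) (x := x) (d := d)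
      (T := b.time.eval (s.reg 0)) (M := s.mem) (env := env) (L := s.reg 0)
      (B := b.compile (d + 4)) (f := b.eval s.mem (s.reg 0)) hx hd
      (by
        intro s' env' h' hM hL
        have := ihb hK.2.2 (d := d + 4) (by omega) s' env' h'
        rwa [hM, hL] at this)
      (min (n.eval s.mem (s.reg 0) env) (s.reg 0)) 0 0 s₂ h₂ hm₂ h0
      (by simp [hs₂, State.set, Function.update, show ¬ d = x by omega])
      (by simp [hs₂, State.set, Function.update])
      (by simp [hs₂, State.set])
    have E : Exec ((sum x n b).compile d) s ((s₃.set (x + 1) (s₃.reg d)).set d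
        ((s₃.set (x + 1) (s₃.reg d)).reg (d + 2)))
        (t₁ + (1 + (1 + (1 + (1 + (1 + (1 + (t₃ + (1 + 1))))))))) := by
      refine .seq e₁ (.seq (.copy _ _ _) (.seq (.sub _ _ _ _) (.seq (.sub _ _ _ _)
        (.seq (.const _ _ _) (.seq (.const _ _ _) (.seq (.const _ _ _) (.seq (s' := s₃) (t := t₃)
          ?_ (.seq (.copy _ _ _) (.copy _ _ _)))))))))
      convert e₃ using 1
      -- The two truncated subtractions before the loop replace the bound `p` by `p - (p - q)`, with
      -- `q` the input length; this realises the cap.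
      have hmin : ∀ p q : ℕ, p - (p - q) = min p q := by intros; omega
      simp [hs₂, State.set, Function.update, hv, hr (x + 1) (by omega), hr 0 (by omega),
        show ¬ 0 = d by omega, hmin]
      funext y
      simp only [Function.update_apply]
      split_ifs <;> rfl
    refine ⟨_, _, E, ?_, ?_, by simp [State.set, hm₃, hm₂], ?_⟩
    · have hmul := Nat.mul_le_mul_right (b.time.eval (s.reg 0) + 4)
        (min_le_right (n.eval s.mem (s.reg 0) env) (s.reg 0))
      simp only [time, Polynomial.eval_add, Polynomial.eval_mul, Polynomial.eval_X,
        Polynomial.eval_ofNat]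
      omega
    · simp only [zero_add] at hv₃
      simp [State.set, eval, Function.update, show ¬ d + 1 = x by omega]
      rw [hv₃]
    · intro r hrd
      by_cases hrx : r = x + 1
      · subst hrx
        simp [State.set, Function.update, hrd.ne, hr₃ d le_rfl (by omega), hs₂,
          show ¬ d = x + 1 by omega]
      · simp [State.set, Function.update, hrd.ne, hrx, hr₃ r hrd.le hrx, hs₂, hr r (by omega),
          show ¬ r = d + 1 by omega, show ¬ r = d + 2 by omega, show ¬ r = d + 3 by omega]

end Expr

theorem polynomial_eval_mono (q : Polynomial ℕ) : Monotone fun n => q.eval n := by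
  intro m n h
  simp only [Polynomial.eval_eq_sum, Polynomial.sum]
  gcongr

theorem length_le_inputSize (l : List ℕ) : l.length ≤ inputSize l := by
  induction l with
  | nil => simp
  | cons a l ih =>
    simp only [inputSize, List.map_cons, List.sum_cons, List.length_cons] at ih ⊢
    omega

/-- The running time is polynomial in the number of input entries, which the binary size dominates.
The result moves to register `0` only at the end, since until then this register supplies the loop
cap. -/
theorem decidableInPolyTime_of_expr {α : Type} {code : α → List ℕ} {S : Set α} (e : Expr)
    (h : ∀ I, e.eval (fun i => (code I).getD i 0) (code I).length (fun _ => 0) ≠ 0 ↔ I ∈ S) :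
    DecidableInPolyTime code S := by
  refine ⟨.seq (e.compile (e.fresh + 1)) (.copy 0 (e.fresh + 1)), e.time + 1, fun I => ?_⟩
  obtain ⟨s, t, he, ht, hv, -⟩ := e.computes_compile le_rfl (Nat.lt_succ_self _)
    (initial (code I)) (fun _ => 0) (fun x _ => by simp [initial])
  refine ⟨_, _, .seq he (.copy _ _ _), ?_, ?_⟩
  · have := polynomial_eval_mono e.time (length_le_inputSize (code I))
    simp [initial] at ht this ⊢
    omega
  · rw [← h]
    simp only [State.set, Function.update_self]
    rw [hv]
    simp [initial]

end RAM

/-! ## Expressions that read an instance -/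

namespace RAM.Expr

/-- `if a < b then t else f`. -/
def ifLt (a b t f : Expr) : Expr := ite (sub b a) t f

/-- `if a = b then t else f`. -/
def ifEq (a b t f : Expr) : Expr := ite (sub a b) f (ite (sub b a) f t)

/-- The minimum of two numbers. -/
def least (a b : Expr) : Expr := sub a (sub a b)

variable (M : ℕ → ℕ) (L : ℕ) (env : ℕ → ℕ) (a b t f : Expr)

@[simp] theorem eval_var (x : ℕ) : (var x).eval M L env = env x := by
  simp only [eval]

@[simp] theorem eval_const (n : ℕ) : (const n).eval M L env = n := by
  simp only [eval]

@[simp] theorem eval_cell : (cell a).eval M L env = M (a.eval M L env) := by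
  simp only [eval]

@[simp] theorem eval_add : (add a b).eval M L env = a.eval M L env + b.eval M L env := by
  simp only [eval]

@[simp] theorem eval_sub : (sub a b).eval M L env = a.eval M L env - b.eval M L env := by
  simp only [eval]

@[simp] theorem eval_ite : (ite a t f).eval M L env =
    if a.eval M L env = 0 then f.eval M L env else t.eval M L env := by
  simp only [eval, ite_not]

@[simp] theorem eval_bind (x : ℕ) : (bind x a b).eval M L env =
    b.eval M L (Function.update env x (a.eval M L env)) := by
  simp only [eval]

theorem eval_sum (x : ℕ) : (sum x a b).eval M L env =
    ∑ i ∈ Finset.range (min (a.eval M L env) L), b.eval M L (Function.update env x i) := rfl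

theorem eval_sum_of_le {n : ℕ} (x : ℕ) (hn : a.eval M L env = n) (h : n ≤ L) :
    (sum x a b).eval M L env =
      ∑ i ∈ Finset.range n, b.eval M L (Function.update env x i) := by
  rw [eval_sum, hn, min_eq_left h]

@[simp] theorem eval_ifLt : (ifLt a b t f).eval M L env =
    if a.eval M L env < b.eval M L env then t.eval M L env else f.eval M L env := by
  by_cases h : a.eval M L env < b.eval M L env
  · have : b.eval M L env - a.eval M L env ≠ 0 := by omega
    simp [ifLt, h, this]
  · have : b.eval M L env - a.eval M L env = 0 := by omega
    simp [ifLt, h, this]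

@[simp] theorem eval_ifEq : (ifEq a b t f).eval M L env =
    if a.eval M L env = b.eval M L env then t.eval M L env else f.eval M L env := by
  simp only [ifEq, eval_ite, eval_sub]
  rcases lt_trichotomy (a.eval M L env) (b.eval M L env) with h | h | h
  · rw [if_pos (by omega), if_neg (by omega), if_neg h.ne]
  · rw [if_pos (by omega), if_pos (by omega), if_pos h]
  · rw [if_neg (by omega), if_neg h.ne']

@[simp] theorem eval_least : (least a b).eval M L env = min (a.eval M L env) (b.eval M L env) := by
  simp only [least, eval_sub]
  omega

end RAM.Expr

/-! ### Index sums as counts, and lists composed of blocks of equal length -/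

theorem List.sum_range_eq_countP {β : Type*} (P : β → Bool) (l : List β) : ∀ (f : ℕ → ℕ),
    (∀ k (hk : k < l.length), f k = if P l[k] then 1 else 0) →
    ∑ k ∈ Finset.range l.length, f k = l.countP P := by
  induction l with
  | nil => simp
  | cons a l ih =>
    intro f h
    rw [List.length_cons, Finset.sum_range_succ', List.countP_cons,
      ih (fun k => f (k + 1)) fun k hk => h (k + 1) (by simpa using hk)]
    exact congrArg (_ + ·) (h 0 (by simp))

theorem List.sum_range_eq_sum_map {β : Type*} (l : List β) (g : β → ℕ) : ∀ (f : ℕ → ℕ),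
    (∀ k (hk : k < l.length), f k = g l[k]) →
    ∑ k ∈ Finset.range l.length, f k = (l.map g).sum := by
  induction l with
  | nil => simp
  | cons a l ih =>
    intro f h
    rw [List.length_cons, Finset.sum_range_succ', List.map_cons, List.sum_cons,
      ih (fun k => f (k + 1)) fun k hk => h (k + 1) (by simpa using hk), add_comm]
    exact congrArg (· + _) (h 0 (by simp))

theorem List.getD_flatMap_of_length {β : Type*} {f : β → List ℕ} {m : ℕ} (l : List β)
    (hf : ∀ b ∈ l, (f b).length = m) (k j : ℕ) (hk : k < l.length) (hj : j < m) :
    (l.flatMap f).getD (k * m + j) 0 = (f l[k]).getD j 0 := by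
  induction l generalizing k with
  | nil => simp at hk
  | cons a l ih =>
    have ha : (f a).length = m := hf a (by simp)
    cases k with
    | zero => rw [List.flatMap_cons, zero_mul, zero_add, List.getD_append _ _ _ _ (by omega)]; simp
    | succ k =>
      rw [List.flatMap_cons, List.getD_append_right _ _ _ _ (by rw [ha]; nlinarith)]
      have : (k + 1) * m + j - (f a).length = k * m + j := by rw [ha, add_mul]; omega
      rw [this, ih (fun b hb => hf b (by simp [hb])) k (by simpa using hk)]
      simp

/-! ### The memory layout of an encoded instance -/

namespace Voting

open RAM

/-- The code of a ballot has one entry for each candidate. -/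
class UniformBallotKind (B : Type) extends BallotKind B where
  length_code : ∀ (cs : List ℕ) (b : B), cs.Nodup → BallotKind.IsOver b cs.toFinset →
    (BallotKind.code cs b).length = cs.length

instance : UniformBallotKind PrefList where
  length_code cs b hcs hb := by
    change b.length = _
    rw [← List.toFinset_card_of_nodup hcs, ← List.toFinset_card_of_nodup hb.1, hb.2]

instance : UniformBallotKind ApprovalBallot where
  length_code cs b _ _ := by simp [BallotKind.code]

namespace ControlInstance

variable {B : Type} [UniformBallotKind B] (I : ControlInstance B)

/-- All candidates, qualified ones first. -/
def cands : List ℕ := I.C ++ I.A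

/-- All voters, registered ones first. -/
def voters : List B := I.V ++ I.W

/-- The memory of a machine that is started on the instance. -/
def mem : ℕ → ℕ := fun i => I.code.getD i 0

theorem nodup_cands : I.cands.Nodup :=
  List.nodup_append.2 ⟨I.nodup_C, I.nodup_A, fun _ ha _ hb hab => I.disjoint ha (hab ▸ hb)⟩

theorem isOver_voters {b : B} (hb : b ∈ I.voters) : BallotKind.IsOver b I.cands.toFinset := by
  rw [cands, List.toFinset_append]
  exact (List.mem_append.1 hb).elim (I.ballots_V b) (I.ballots_W b)

theorem length_code_voters {b : B} (hb : b ∈ I.voters) :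
    (BallotKind.code I.cands b).length = I.cands.length :=
  UniformBallotKind.length_code _ _ I.nodup_cands (I.isOver_voters hb)

theorem code_eq : I.code = [I.C.length, I.A.length, I.V.length, I.W.length, I.p, I.kAC, I.kDC,
    I.kAV, I.kDV, I.kBV] ++ (I.cands ++ I.voters.flatMap (BallotKind.code I.cands)) := by
  simp [code, voters, cands]

theorem mem_cand {i : ℕ} (hi : i < I.cands.length) : I.mem (10 + i) = I.cands[i] := by
  rw [mem, code_eq, List.getD_append_right _ _ _ _ (by simp), List.getD_append _ _ _ _ (by simpa)]
  simp [hi]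

theorem getElem_cands_mem_iff {i : ℕ} {hi : i < I.cands.length} :
    I.cands[i] ∈ I.C ↔ i < I.C.length := by
  constructor
  · intro h
    by_contra hlt
    have : I.cands[i] ∈ I.A := by
      simp only [cands, List.getElem_append_right (not_lt.1 hlt)]
      exact List.getElem_mem _
    exact I.disjoint h this
  · intro h
    simp only [cands, List.getElem_append_left h]
    exact List.getElem_mem h

/-- Ten header cells and the names of the candidates precede the ballots, and all ballots,
registered ones first, form one array of blocks of equal length. -/
theorem mem_ballot {k j : ℕ} (hk : k < I.voters.length) (hj : j < I.cands.length) :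
    I.mem (10 + I.cands.length + k * I.cands.length + j) =
      (BallotKind.code I.cands I.voters[k]).getD j 0 := by
  rw [mem, code_eq, List.getD_append_right _ _ _ _ (by simp; omega),
    List.getD_append_right _ _ _ _ (by simp; omega),
    ← List.getD_flatMap_of_length _ (fun b hb => I.length_code_voters hb) k j hk hj]
  congr 1
  simp
  omega

theorem length_cands_pos : 0 < I.cands.length :=
  List.length_pos_of_mem (List.mem_append_left _ I.p_mem)

theorem length_cands_le : I.cands.length ≤ I.code.length := by
  simp [code_eq]
  omega

/-- Because `p` is a candidate, every ballot occupies at least one cell. So the loop cap never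
truncates a sum over voters. -/
theorem length_voters_le : I.voters.length ≤ I.code.length := by
  have h : (I.voters.flatMap (BallotKind.code I.cands)).length =
      I.voters.length * I.cands.length := by
    rw [List.length_flatMap, List.map_congr_left fun b hb => I.length_code_voters hb]
    simp
  have := Nat.mul_le_mul_left I.voters.length I.length_cands_pos
  rw [code_eq]
  simp only [List.length_append, h]
  omega

theorem length_V_le : I.V.length ≤ I.code.length :=
  le_trans (by simp [voters]) I.length_voters_le

theorem length_W_le : I.W.length ≤ I.code.length :=
  le_trans (by simp [voters]) I.length_voters_le

@[simp] theorem mem_zero : I.mem 0 = I.C.length := rfl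
@[simp] theorem mem_one : I.mem 1 = I.A.length := rfl
@[simp] theorem mem_two : I.mem 2 = I.V.length := rfl
@[simp] theorem mem_three : I.mem 3 = I.W.length := rfl
@[simp] theorem mem_four : I.mem 4 = I.p := rfl
@[simp] theorem mem_five : I.mem 5 = I.kAC := rfl
@[simp] theorem mem_six : I.mem 6 = I.kDC := rfl
@[simp] theorem mem_seven : I.mem 7 = I.kAV := rfl
@[simp] theorem mem_eight : I.mem 8 = I.kDV := rfl
@[simp] theorem mem_nine : I.mem 9 = I.kBV := rfl

/-- The value of an expression on an instance. -/
abbrev val (e : Expr) (env : ℕ → ℕ) : ℕ := e.eval I.mem I.code.length env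

end ControlInstance

/-! ### Expressions for ranks in ballots and for comparisons of two candidates -/

open Expr

/-- The number of all candidates. -/
def candCount : Expr := add (cell (const 0)) (cell (const 1))

/-- The entry number `j` of the code of the voter that is held in variable `20`. -/
def ballotEntry (j : Expr) : Expr :=
  cell (add (add (add (const 10) candCount) (sum 22 (var 20) candCount)) j)

/-- The position of the candidate `x` in the preference list of the voter. -/
def positionExpr (x : ℕ) : Expr :=
  sum 21 candCount (ifEq (ballotEntry (var 21)) (var x) (var 21) (const 0))

/-- `0` if the candidate `x` heads the preference list of the voter, and `1` otherwise. -/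
def topExpr (x : ℕ) : Expr := ifEq (ballotEntry (const 0)) (var x) (const 0) (const 1)

/-- `0` if the voter approves of the candidate `x`, and `1` otherwise. -/
def disapprovalExpr (x : ℕ) : Expr :=
  sum 21 candCount (ifEq (cell (add (const 10) (var 21))) (var x)
    (sub (const 1) (ballotEntry (var 21))) (const 0))

/-- The number of registered voters for whom `x` has a smaller value of `R` than `y` has. -/
def countV (R : ℕ → Expr) (x y : ℕ) : Expr :=
  sum 20 (cell (const 2)) (ifLt (R x) (R y) (const 1) (const 0))

/-- The number of unregistered voters for whom `x` has a smaller value of `R` than `y` has. -/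
def countW (R : ℕ → Expr) (x y : ℕ) : Expr :=
  sum 19 (cell (const 3)) (bind 20 (add (cell (const 2)) (var 19))
    (ifLt (R x) (R y) (const 1) (const 0)))

/-- The number of voters in `U` for whom `c` has a smaller rank than `c'` has. -/
def ahead {B : Type} (rank : B → ℕ → ℕ) (U : List B) (c c' : ℕ) : ℕ :=
  U.countP fun b => rank b c < rank b c'

namespace ControlInstance

variable {B : Type} [UniformBallotKind B] (I : ControlInstance B)

/-- The expressions `R x` compute the rank of the candidate `x` in the ballot of the voter. -/
def RankSpec (rank : B → ℕ → ℕ) (R : ℕ → Expr) : Prop :=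
  ∀ (env : ℕ → ℕ) (h : env 20 < I.voters.length), ∀ x < 19, env x ∈ I.cands →
    I.val (R x) env = rank I.voters[env 20] (env x)

@[simp] theorem val_candCount (env : ℕ → ℕ) : I.val candCount env = I.cands.length := by
  simp [candCount, cands]

/-- The machine does not multiply: the offset of the ballot is a sum that adds the number of
candidates once for each preceding voter. -/
theorem val_ballotEntry {env : ℕ → ℕ} (h : env 20 < I.voters.length) {j : Expr}
    (hj : I.val j env < I.cands.length) :
    I.val (ballotEntry j) env = (BallotKind.code I.cands I.voters[env 20]).getD (I.val j env) 0 := by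
  have := I.val_candCount
  simp only [val] at this hj ⊢
  rw [← I.mem_ballot h hj, ballotEntry]
  simp [eval_sum, this, min_eq_left (h.le.trans I.length_voters_le)]

variable {I} {rank : B → ℕ → ℕ} {R : ℕ → Expr}

/-- The bounds by `19` keep the variables that name candidates clear of the variables `19` to `22`,
which serve as voter indices and inner loop indices. -/
theorem RankSpec.val_countV (hR : I.RankSpec rank R) {env : ℕ → ℕ} {x y : ℕ} (hx : x < 19)
    (hy : y < 19) (hx' : env x ∈ I.cands) (hy' : env y ∈ I.cands) :
    I.val (countV R x y) env = ahead rank I.V (env x) (env y) := by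
  rw [val, countV, eval_sum_of_le _ _ _ _ _ _ (by simp) I.length_V_le]
  refine List.sum_range_eq_countP _ _ _ fun k hk => ?_
  have hxk : ∀ z < 19, Function.update env 20 k z = env z := fun z hz =>
    Function.update_of_ne (by omega) _ _
  have h1 := hR (Function.update env 20 k) (by simp [voters]; omega) x hx (by rwa [hxk x hx])
  have h2 := hR (Function.update env 20 k) (by simp [voters]; omega) y hy (by rwa [hxk y hy])
  rw [hxk x hx] at h1
  rw [hxk y hy] at h2
  simp only [Function.update_self, voters, List.getElem_append_left hk, val] at h1 h2
  simp [h1, h2]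

theorem RankSpec.val_countW (hR : I.RankSpec rank R) {env : ℕ → ℕ} {x y : ℕ} (hx : x < 19)
    (hy : y < 19) (hx' : env x ∈ I.cands) (hy' : env y ∈ I.cands) :
    I.val (countW R x y) env = ahead rank I.W (env x) (env y) := by
  rw [val, countW, eval_sum_of_le _ _ _ _ _ _ (by simp) I.length_W_le]
  refine List.sum_range_eq_countP _ _ _ fun k hk => ?_
  -- The unregistered voter number `k` has index `I.V.length + k` in the joint list of voters.
  have hxk : ∀ z < 19, Function.update (Function.update env 19 k) 20 (I.V.length + k) z = env z :=
    fun z hz => by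
      rw [Function.update_of_ne (by omega), Function.update_of_ne (by omega)]
  have h1 := hR (Function.update (Function.update env 19 k) 20 (I.V.length + k))
    (by simp [voters]; omega) x hx (by rwa [hxk x hx])
  have h2 := hR (Function.update (Function.update env 19 k) 20 (I.V.length + k))
    (by simp [voters]; omega) y hy (by rwa [hxk y hy])
  rw [hxk x hx] at h1
  rw [hxk y hy] at h2
  simp only [Function.update_self, voters, val] at h1 h2
  simp [h1, h2]

end ControlInstance

/-- A ballot lists every candidate exactly once, so only the term at the position of the candidate
can contribute to the sum, and it contributes that position. -/
theorem rankSpec_position (I : ControlInstance PrefList) :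
    I.RankSpec (fun b c => b.idxOf c) positionExpr := by
  intro env h x hx hxc
  have hb := I.isOver_voters (List.getElem_mem h)
  have hlen := I.length_code_voters (List.getElem_mem h)
  have hcand := I.val_candCount
  have hmem : env x ∈ I.voters[env 20] := by
    rw [← List.mem_toFinset, hb.2]
    simpa using hxc
  have hi := List.idxOf_lt_length_iff.2 hmem
  change I.voters[env 20].length = _ at hlen
  rw [ControlInstance.val, positionExpr, eval_sum_of_le _ _ _ _ _ _ (hcand _) I.length_cands_le]
  have key : ∀ j < I.cands.length,
      (ifEq (ballotEntry (var 21)) (var x) (var 21) (const 0)).eval I.mem I.code.length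
        (Function.update env 21 j) =
      if j = I.voters[env 20].idxOf (env x) then I.voters[env 20].idxOf (env x) else 0 := by
    intro j hj
    have h1 := I.val_ballotEntry (env := Function.update env 21 j) (j := var 21) (by simpa using h)
      (by simpa using hj)
    simp only [ControlInstance.val] at h1
    have h20 : Function.update env 21 j 20 = env 20 := by simp
    simp only [h20, eval_var, Function.update_self] at h1
    have hx21 : x ≠ 21 := by omega
    simp only [eval_ifEq, h1, eval_var, eval_const, Function.update_self, ne_eq, hx21,
      not_false_eq_true, Function.update_of_ne]
    change (if I.voters[env 20].getD j 0 = _ then _ else _) = _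
    rw [List.getD_eq_getElem _ _ (by omega)]
    by_cases hji : j = I.voters[env 20].idxOf (env x)
    · subst hji
      simp
    · rw [if_neg hji, if_neg]
      rintro heq
      apply hji
      rw [← heq, hb.1.idxOf_getElem]
  rw [Finset.sum_congr rfl fun j hj => key j (Finset.mem_range.1 hj), Finset.sum_ite_eq']
  rw [if_pos (Finset.mem_range.2 (by omega))]

theorem rankSpec_top (I : ControlInstance PrefList) :
    I.RankSpec (fun b c => if b.head? = some c then 0 else 1) topExpr := by
  intro env h x hx hxc
  have hlen := I.length_code_voters (List.getElem_mem h)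
  change I.voters[env 20].length = _ at hlen
  have h1 := I.val_ballotEntry (env := env) (j := const 0) h I.length_cands_pos
  have hpos := I.length_cands_pos
  simp only [ControlInstance.val] at h1
  simp only [topExpr, ControlInstance.val, eval_ifEq, h1, eval_var, eval_const]
  change (if I.voters[env 20].getD 0 0 = _ then _ else _) = _
  rw [List.getD_eq_getElem _ _ (by omega), List.head?_eq_getElem?,
    List.getElem?_eq_getElem (by omega)]
  simp

/-- An approval vector is indexed by places in the list of candidates, not by names. That list has
no duplicates, so the sum selects exactly one entry. -/
theorem rankSpec_disapproval (I : ControlInstance ApprovalBallot) :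
    I.RankSpec (fun b c => if c ∈ b then 0 else 1) disapprovalExpr := by
  intro env h x hx hxc
  have hcand := I.val_candCount
  have hi := List.idxOf_lt_length_iff.2 hxc
  rw [ControlInstance.val, disapprovalExpr, eval_sum_of_le _ _ _ _ _ _ (hcand _) I.length_cands_le]
  have key : ∀ j < I.cands.length,
      (ifEq (cell (add (const 10) (var 21))) (var x) (sub (const 1) (ballotEntry (var 21)))
        (const 0)).eval I.mem I.code.length (Function.update env 21 j) =
      if j = I.cands.idxOf (env x) then (if env x ∈ I.voters[env 20] then 0 else 1) else 0 := by
    intro j hj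
    have h1 := I.val_ballotEntry (env := Function.update env 21 j) (j := var 21) (by simpa using h)
      (by simpa using hj)
    simp only [ControlInstance.val] at h1
    have h20 : Function.update env 21 j 20 = env 20 := by simp
    simp only [h20, eval_var, Function.update_self] at h1
    have hx21 : x ≠ 21 := by omega
    simp only [eval_ifEq, h1, eval_var, eval_const, Function.update_self, ne_eq, hx21,
      not_false_eq_true, Function.update_of_ne, eval_cell, eval_add, eval_sub, I.mem_cand hj]
    by_cases hji : j = I.cands.idxOf (env x)
    · subst hji
      by_cases hb : env x ∈ I.voters[env 20] <;> simp [BallotKind.code, hi, hb]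
    · rw [if_neg hji, if_neg]
      rintro heq
      apply hji
      rw [← heq, I.nodup_cands.idxOf_getElem]
  rw [Finset.sum_congr rfl fun j hj => key j (Finset.mem_range.1 hj), Finset.sum_ite_eq']
  rw [if_pos (Finset.mem_range.2 (by omega))]

end Voting

/-! ## Destructive control by adding candidates and adding, deleting and bribing voters -/

namespace List

variable {β : Type*}

/-- Bribery is measured by the number of places where two ballot lists differ; each such place
changes a count by at most one. -/
theorem countP_le_countP_add_zip [DecidableEq β] (P : β → Bool) :
    ∀ {l l' : List β}, l'.length = l.length →
    l.countP P ≤ l'.countP P + (l.zip l').countP fun x => x.1 ≠ x.2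
  | [], _, _ => by simp
  | _ :: _, [], h => by simp at h
  | a :: l, b :: l', h => by
    have ih := countP_le_countP_add_zip P (l := l) (l' := l') (by simpa using h)
    rw [zip_cons_cons, countP_cons, countP_cons, countP_cons]
    by_cases hab : a = b
    · subst hab
      omega
    · rw [if_pos (c := decide ((a, b).1 ≠ (a, b).2) = true) (by simpa using hab)]
      split_ifs <;> omega

theorem countP_zip_comm [DecidableEq β] : ∀ l l' : List β,
    (l'.zip l).countP (fun x => x.1 ≠ x.2) = (l.zip l').countP fun x => x.1 ≠ x.2
  | [], _ => by simp
  | _ :: _, [] => by simp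
  | a :: l, b :: l' => by
    simp only [zip_cons_cons, countP_cons, countP_zip_comm l l', ne_comm]

theorem countP_le_countP_add_zip' [DecidableEq β] (P : β → Bool) {l l' : List β}
    (h : l'.length = l.length) :
    l'.countP P ≤ l.countP P + (l.zip l').countP fun x => x.1 ≠ x.2 := by
  rw [← countP_zip_comm l l']
  exact countP_le_countP_add_zip P h.symm

theorem countP_zip_self [DecidableEq β] (l : List β) : ((l.zip l).countP fun x => x.1 ≠ x.2) = 0 := by
  induction l with
  | nil => rfl
  | cons a l ih => simpa using ih

theorem Sublist.countP_le_countP_add {l l' : List β} (P : β → Bool) (h : l.Sublist l') {k : ℕ}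
    (hk : l'.length ≤ l.length + k) : l'.countP P ≤ l.countP P + k := by
  have h1 := h.countP_le (p := fun a => !P a)
  have h2 := l.length_eq_countP_add_countP (p := P)
  have h3 := l'.length_eq_countP_add_countP (p := P)
  simp only [decide_not, Bool.decide_eq_true] at h2 h3
  omega

/-- Up to `k` elements that satisfy `P` can be deleted. -/
theorem exists_sublist_countP_sub (P : β → Bool) (l : List β) : ∀ k, ∃ l' : List β,
    l'.Sublist l ∧ l.length ≤ l'.length + k ∧ l'.countP P = l.countP P - k ∧
      ∀ Q : β → Bool, (∀ b, Q b → ¬ P b) → l'.countP Q = l.countP Q := by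
  induction l with
  | nil => exact fun k => ⟨[], by simp⟩
  | cons a l ih =>
    intro k
    by_cases ha : P a ∧ 0 < k
    · obtain ⟨l', h1, h2, h3, h4⟩ := ih (k - 1)
      refine ⟨l', h1.cons a, by simp; omega, by simp [ha.1, h3]; omega, fun Q hQ => ?_⟩
      have : ¬ Q a := fun h => hQ a h ha.1
      simp [this, h4 Q hQ]
    · obtain ⟨l', h1, h2, h3, h4⟩ := ih k
      refine ⟨a :: l', h1.cons_cons a, by simp; omega, ?_, fun Q hQ => ?_⟩
      · rw [countP_cons, countP_cons, h3]
        split_ifs with h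
        · have : k = 0 := by by_contra hk; exact ha ⟨h, by omega⟩
          omega
        · rfl
      · simp [countP_cons, h4 Q hQ]

/-- Up to `k` elements that satisfy `P` can be replaced by `b₀`. -/
theorem exists_replace [DecidableEq β] (P : β → Bool) {b₀ : β} (hP : ¬ P b₀) (l : List β) :
    ∀ k, ∃ l' : List β,
    l'.length = l.length ∧ ((l.zip l').countP fun x => x.1 ≠ x.2) ≤ k ∧
      (∀ b ∈ l', b ∈ l ∨ b = b₀) ∧ l'.countP P = l.countP P - k ∧
      ∀ Q : β → Bool, (∀ b, Q b → ¬ P b) → Q b₀ →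
        l'.countP Q = l.countP Q + min k (l.countP P) := by
  induction l with
  | nil => exact fun k => ⟨[], by simp⟩
  | cons a l ih =>
    intro k
    by_cases ha : P a ∧ 0 < k
    · obtain ⟨l', h1, h2, h3, h4, h5⟩ := ih (k - 1)
      refine ⟨b₀ :: l', by simp [h1], ?_, ?_, by simp [ha.1, h4, hP]; omega, fun Q hQ hQ0 => ?_⟩
      · rw [zip_cons_cons, countP_cons]
        split_ifs <;> omega
      · rintro b hb
        rcases mem_cons.1 hb with rfl | hb
        · exact Or.inr rfl
        · exact (h3 b hb).imp_left (mem_cons_of_mem a)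
      · have : ¬ Q a := fun h => hQ a h ha.1
        simp [this, h5 Q hQ hQ0, hQ0, ha.1]
        omega
    · obtain ⟨l', h1, h2, h3, h4, h5⟩ := ih k
      refine ⟨a :: l', by simp [h1], by simpa using h2, ?_, ?_, fun Q hQ hQ0 => ?_⟩
      · rintro b hb
        rcases mem_cons.1 hb with rfl | hb
        · exact Or.inl (by simp)
        · exact (h3 b hb).imp_left (mem_cons_of_mem a)
      · rw [countP_cons, countP_cons, h4]
        split_ifs with h
        · have : k = 0 := by by_contra hk; exact ha ⟨h, by omega⟩
          omega
        · rfl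
      · rw [countP_cons, countP_cons, countP_cons, h5 Q hQ hQ0]
        split_ifs with h1 h2 h2
        · exact absurd h2 (hQ a h1)
        · omega
        · have : k = 0 := by by_contra hk; exact ha ⟨h2, by omega⟩
          omega
        · omega

end List

namespace Voting

open RAM RAM.Expr

variable {B : Type} [UniformBallotKind B]

/-- Some candidate who can take part catches up with `p`, given the limits on the voters. -/
def ControlInstance.Beatable (I : ControlInstance B) (rank : B → ℕ → ℕ) : Prop :=
  ∃ c ∈ I.cands, c ≠ I.p ∧ (c ∈ I.C ∨ 0 < I.kAC) ∧
    ahead rank I.V I.p c ≤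
      ahead rank I.V c I.p + min I.kAV (ahead rank I.W c I.p) + I.kDV + (I.kBV + I.kBV)

/-- The presence of third candidates is irrelevant to the comparison in `hE`, so a successful attack
is one that lets a single surviving rival `c` draw level. The bound is necessary because a deletion
costs `p` at most one ballot, an added voter helps only if `c` is ahead there, and a bribe shifts
the difference by at most two. Spending everything on one `c` attains it. -/
theorem controllable_destructive_iff [DecidableEq B] {E : ElectionSystem B}
    {I : ControlInstance B} {rank : B → ℕ → ℕ}
    (hE : ∀ S U, I.CanReach S U → (IsUniqueWinner E S U I.p ↔
      ∀ c ∈ S, c ≠ I.p → ahead rank U c I.p < ahead rank U I.p c))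
    (hrank : ∀ c ∈ I.cands, c ≠ I.p →
      ∃ b, BallotKind.IsOver b I.cands.toFinset ∧ rank b c < rank b I.p) :
    Controllable E .destructive I ↔ I.Beatable rank := by
  constructor
  · rintro ⟨S, U, hSU, hgoal⟩
    have hgoal' : ¬ IsUniqueWinner E S U I.p := hgoal
    rw [hE S U hSU] at hgoal'
    push Not at hgoal'
    obtain ⟨c, hc, hcp, hle⟩ := hgoal'
    obtain ⟨A', C', V₀, W', hA, hAk, -, -, -, hV, hVk, hW, hWk, rfl, hlen, hdiff, -⟩ := hSU
    have hc' : c ∈ I.C ∨ c ∈ I.A ∧ 0 < I.kAC := by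
      rcases Finset.mem_union.1 hc with hc | hc
      · exact Or.inl (List.mem_toFinset.1 (Finset.mem_sdiff.1 hc).1)
      · exact Or.inr ⟨List.mem_toFinset.1 (hA hc), (Finset.card_pos.2 ⟨c, hc⟩).trans_le hAk⟩
    refine ⟨c, ?_, hcp, hc'.imp_right And.right, ?_⟩
    · rw [ControlInstance.cands, List.mem_append]
      exact hc'.imp_right And.left
    · have h1 := hV.countP_le_countP_add (fun b => rank b I.p < rank b c) hVk
      have h2 := List.countP_le_countP_add_zip (fun b => rank b I.p < rank b c) hlen
      have h3 := List.countP_le_countP_add_zip' (fun b => rank b c < rank b I.p) hlen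
      have h4 := hV.countP_le (p := fun b => rank b c < rank b I.p)
      have h5 := hW.countP_le (p := fun b => rank b c < rank b I.p)
      have h6 := W'.countP_le_length (p := fun b => rank b c < rank b I.p)
      simp only [List.countP_append] at h2 h3
      simp only [ahead] at hle ⊢
      omega
  · rintro ⟨c, hc, hcp, hcA, hle⟩
    set P : B → Bool := fun b => rank b I.p < rank b c with hP
    set Q : B → Bool := fun b => rank b c < rank b I.p with hQ
    have hQP : ∀ b, Q b → ¬ P b := fun b => by simp only [hP, hQ, decide_eq_true_eq]; omega
    obtain ⟨b₀, hb₀, hb₀'⟩ := hrank c hc hcp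
    have hQ0 : Q b₀ := by simpa [hQ] using hb₀'
    -- Greedy attack: delete voters with `p` ahead of `c`, add voters with `c` ahead, then turn
    -- remaining voters with `p` ahead to `b₀`. Truncation is harmless: if the voters with `p` ahead
    -- run out, the count of `p` is zero and `c` has drawn level anyway.
    obtain ⟨V₀, hV, hVk, hVP, hVQ⟩ := List.exists_sublist_countP_sub P I.V I.kDV
    obtain ⟨U, hlen, hdiff, hU, hUP, hUQ⟩ := List.exists_replace P (hQP b₀ hQ0)
      (V₀ ++ (I.W.filter Q).take I.kAV) I.kBV
    have hWQ : ((I.W.filter Q).take I.kAV).countP Q = min I.kAV (I.W.countP Q) := by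
      rw [List.countP_eq_length.2 fun b hb => (List.mem_filter.1 (List.mem_of_mem_take hb)).2,
        List.length_take, List.countP_eq_length_filter]
    have hWP : ((I.W.filter Q).take I.kAV).countP P = 0 :=
      List.countP_eq_zero.2 fun b hb => hQP b (List.mem_filter.1 (List.mem_of_mem_take hb)).2
    have hW : ((I.W.filter Q).take I.kAV).Sublist I.W :=
      (List.take_sublist _ _).trans List.filter_sublist
    -- No candidate needs to be deleted, and the only one worth adding is `c` itself, if it is a
    -- spoiler.
    have hcS : c ∈ I.C.toFinset \ ∅ ∪ (if c ∈ I.C then ∅ else {c}) := by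
      split_ifs with h <;> simp [h]
    have hreach : I.CanReach (I.C.toFinset \ ∅ ∪ if c ∈ I.C then ∅ else {c}) U := by
      refine ⟨_, ∅, V₀, _, ?_, ?_, by simp, by simp, by simp, hV, hVk, hW, by simp, rfl, hlen,
        hdiff, ?_⟩
      · split_ifs with h
        · simp
        · simpa using (List.mem_append.1 hc).resolve_left h
      · split_ifs with h
        · simp
        · simpa [Nat.one_le_iff_ne_zero, Nat.pos_iff_ne_zero] using hcA.resolve_left h
      · intro b hb
        rcases hU b hb with hb | rfl
        · rcases List.mem_append.1 hb with hb | hb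
          · exact I.ballots_V b (hV.subset hb)
          · exact I.ballots_W b (hW.subset hb)
        · simpa [ControlInstance.cands] using hb₀
    refine ⟨_, U, hreach, ?_⟩
    change ¬ IsUniqueWinner E _ U I.p
    rw [hE _ U hreach]
    intro h
    have hlt := h c hcS hcp
    have hUQ' := hUQ Q hQP hQ0
    have hVQ' := hVQ Q hQP
    simp only [List.countP_append, hWQ, hWP] at hUP hUQ'
    change U.countP Q < U.countP P at hlt
    change I.V.countP P ≤ I.V.countP Q + min I.kAV (I.W.countP Q) + I.kDV + _ at hle
    omega

/-- An expression that is nonzero iff `body` is nonzero for some rival of `p` that can take part;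
variable `0` holds `p`, and the variables `1` and `2` hold the index and the name of the rival. -/
def searchExpr (body : Expr) : Expr :=
  bind 0 (cell (const 4)) (sum 1 candCount (bind 2 (cell (add (const 10) (var 1)))
    (ifEq (var 2) (var 0) (const 0)
      (ite (add (cell (const 5)) (ifLt (var 1) (cell (const 0)) (const 1) (const 0))) body
        (const 0)))))

/-- A sum of natural numbers serves as an existential quantifier, and the sum of `kAC` and an
indicator as a disjunction. Membership of the rival in `C` is read off its index, as the qualified
candidates come first. -/
theorem val_searchExpr {I : ControlInstance B} {body : Expr} {Q : ℕ → Prop}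
    (hQ : ∀ (env : ℕ → ℕ) (h : env 1 < I.cands.length), env 0 = I.p → env 2 = I.cands[env 1] →
      (I.val body env ≠ 0 ↔ Q (env 2))) (env : ℕ → ℕ) :
    I.val (searchExpr body) env ≠ 0 ↔
      ∃ c ∈ I.cands, c ≠ I.p ∧ (c ∈ I.C ∨ 0 < I.kAC) ∧ Q c := by
  rw [ControlInstance.val, searchExpr, eval_bind,
    eval_sum_of_le _ _ _ _ _ _ (I.val_candCount _) I.length_cands_le]
  have key : ∀ i (hi : i < I.cands.length),
      (bind 2 (cell (add (const 10) (var 1))) (ifEq (var 2) (var 0) (const 0)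
        (ite (add (cell (const 5)) (ifLt (var 1) (cell (const 0)) (const 1) (const 0))) body
          (const 0)))).eval I.mem I.code.length (Function.update (Function.update env 0
            ((cell (const 4)).eval I.mem I.code.length env)) 1 i) ≠ 0 ↔
      (I.cands[i] ≠ I.p ∧ (i < I.C.length ∨ 0 < I.kAC) ∧ Q I.cands[i]) := by
    intro i hi
    set env' : ℕ → ℕ := Function.update (Function.update (Function.update env 0
      ((cell (const 4)).eval I.mem I.code.length env)) 1 i) 2 I.cands[i] with henv
    have e0 : env' 0 = I.p := by simp [henv]
    have e1 : env' 1 = i := by simp [henv]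
    have e2 : env' 2 = I.cands[i] := by simp [henv]
    have hb := hQ env' (by rwa [e1]) e0 (by simp only [e2, e1])
    have hc : (cell (add (const 10) (var 1))).eval I.mem I.code.length
        (Function.update (Function.update env 0
          ((cell (const 4)).eval I.mem I.code.length env)) 1 i) = I.cands[i] := by
      simp [I.mem_cand hi]
    rw [eval_bind, hc, ← henv]
    rw [e2] at hb
    rw [← hb]
    simp only [eval_ifEq, eval_ite, eval_ifLt, eval_add, eval_var, eval_const, eval_cell, e0, e1,
      e2, I.mem_zero, I.mem_five]
    split_ifs <;> simp_all
    omega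
  rw [Ne, Finset.sum_eq_zero_iff]
  push Not
  constructor
  · rintro ⟨i, hi, h⟩
    rw [Finset.mem_range] at hi
    obtain ⟨h1, h2, h3⟩ := (key i hi).1 h
    exact ⟨_, List.getElem_mem hi, h1, h2.imp_left I.getElem_cands_mem_iff.2, h3⟩
  · rintro ⟨c, hc, h1, h2, h3⟩
    obtain ⟨i, hi, rfl⟩ := List.getElem_of_mem hc
    exact ⟨i, Finset.mem_range.2 hi,
      (key i hi).2 ⟨h1, h2.imp_left I.getElem_cands_mem_iff.1, h3⟩⟩

/-- An expression that is nonzero iff some candidate can catch up with the candidate `p`. -/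
def beatableExpr (R : ℕ → Expr) : Expr :=
  searchExpr (ifLt (add (add (add (countV R 2 0) (least (cell (const 7)) (countW R 2 0)))
    (cell (const 8))) (add (cell (const 9)) (cell (const 9)))) (countV R 0 2) (const 0) (const 1))

theorem val_beatableExpr {I : ControlInstance B} {rank : B → ℕ → ℕ} {R : ℕ → Expr}
    (hR : I.RankSpec rank R) (env : ℕ → ℕ) :
    I.val (beatableExpr R) env ≠ 0 ↔ I.Beatable rank := by
  refine val_searchExpr (Q := fun c => _ ≤ _) (fun env h h0 h2 => ?_) env
  have hp : env 0 ∈ I.cands := h0 ▸ List.mem_append_left _ I.p_mem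
  have hc : env 2 ∈ I.cands := h2 ▸ List.getElem_mem h
  have h3 := hR.val_countV (x := 2) (y := 0) (by omega) (by omega) hc hp
  have h4 := hR.val_countV (x := 0) (y := 2) (by omega) (by omega) hp hc
  have h5 := hR.val_countW (x := 2) (y := 0) (by omega) (by omega) hc hp
  simp only [ControlInstance.val, h0] at h3 h4 h5
  simp only [eval_ifLt, eval_add, eval_least, eval_const, eval_cell, h3, h4, h5, I.mem_seven,
    I.mem_eight, I.mem_nine]
  split_ifs <;> omega

theorem decidable_destructive [DecidableEq B] {E : ElectionSystem B} {T : Set Prong}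
    {rank : B → ℕ → ℕ} {R : ℕ → Expr}
    (hR : ∀ I : ControlInstance B, I.RankSpec rank R)
    (hE : ∀ I : ControlInstance B, I.OfType T → ∀ S U, I.CanReach S U →
      (IsUniqueWinner E S U I.p ↔ ∀ c ∈ S, c ≠ I.p → ahead rank U c I.p < ahead rank U I.p c))
    (hrank : ∀ (D : Finset ℕ), ∀ c ∈ D, ∀ p ∈ D, c ≠ p →
      ∃ b : B, BallotKind.IsOver b D ∧ rank b c < rank b p) :
    DecidableInPolyTime (α := {I : ControlInstance B // I.OfType T})
      (fun I => I.1.code) {I | Controllable E .destructive I.1} :=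
  decidableInPolyTime_of_expr (beatableExpr R) fun I => by
    refine (val_beatableExpr (hR I.1) _).trans (controllable_destructive_iff (hE I.1 I.2)
      fun c hc hcp => hrank _ c (by simpa using hc) _ ?_ hcp).symm
    exact List.mem_toFinset.2 (List.mem_append_left _ I.1.p_mem)

end Voting

/-! ## Plurality, approval and Condorcet elections -/

namespace Voting

open RAM RAM.Expr

theorem isUniqueWinner_ofScore {B : Type} [BallotKind B] (score : Finset ℕ → List B → ℕ → ℚ)
    {S : Finset ℕ} {U : List B} {p : ℕ} (hp : p ∈ S) :
    IsUniqueWinner (.ofScore score) S U p ↔ ∀ c ∈ S, c ≠ p →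
      score S (U.map fun b => BallotKind.restrict b S) c <
        score S (U.map fun b => BallotKind.restrict b S) p := by
  simp only [IsUniqueWinner, ElectionSystem.ofScore, Finset.ext_iff, Finset.mem_filter,
    Finset.mem_singleton]
  constructor
  · intro h c hc hcp
    by_contra hlt
    exact hcp ((h c).1 ⟨hc, fun d hd => (((h p).2 rfl).2 d hd).trans (not_lt.1 hlt)⟩)
  · refine fun h c => ⟨fun hc => ?_, ?_⟩
    · by_contra hcp
      exact absurd (hc.2 p hp) (not_le.2 (h c hc.1 hcp))
    · rintro rfl
      refine ⟨hp, fun d hd => ?_⟩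
      by_cases hdc : d = c
      · rw [hdc]
      · exact (h d hd hdc).le

theorem idxOf_filter_lt_iff {P : ℕ → Bool} {c c' : ℕ} (hc : P c) (hc' : P c') :
    ∀ v : List ℕ, (v.filter P).idxOf c < (v.filter P).idxOf c' ↔ v.idxOf c < v.idxOf c'
  | [] => by simp
  | a :: v => by
    have ih := idxOf_filter_lt_iff hc hc' v
    by_cases ha : P a
    · rw [List.filter_cons_of_pos ha]
      by_cases h1 : a = c
      · by_cases h2 : a = c'
        · simp [← h1, ← h2]
        · simp [← h1, h2]
      · by_cases h2 : a = c'
        · simp [h1, ← h2]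
        · simp [h1, h2, ih]
    · have h1 : a ≠ c := fun h => ha (h ▸ hc)
      have h2 : a ≠ c' := fun h => ha (h ▸ hc')
      simp [ha, h1, h2, ih]

/-- Filtering a ballot keeps the relative order of two retained candidates. Hence head-to-head
counts can be taken from the full ballots, whichever other candidates take part. -/
theorem prefers_restrict {S : Finset ℕ} {c c' : ℕ} (hc : c ∈ S) (hc' : c' ∈ S)
    (U : List PrefList) : prefers (U.map fun b => BallotKind.restrict b S) c c' =
      ahead (fun b c => b.idxOf c) U c c' := by
  rw [prefers, ahead, List.countP_map]
  refine List.countP_congr fun b _ => ?_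
  simpa [BallotKind.restrict] using
    idxOf_filter_lt_iff (P := fun c => c ∈ S) (by simpa) (by simpa) b

theorem isUniqueWinner_condorcet {S : Finset ℕ} {U : List PrefList} {p : ℕ} (hp : p ∈ S) :
    IsUniqueWinner condorcet S U p ↔ ∀ c ∈ S, c ≠ p →
      ahead (fun b c => b.idxOf c) U c p < ahead (fun b c => b.idxOf c) U p c := by
  have h : p ∈ condorcet.winners S (U.map fun b => BallotKind.restrict b S) ↔
      ∀ c ∈ S, c ≠ p →
        ahead (fun b c => b.idxOf c) U c p < ahead (fun b c => b.idxOf c) U p c := by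
    simp only [condorcet, Finset.mem_filter, hp, true_and]
    refine forall₂_congr fun c hc => ?_
    rw [prefers_restrict hc hp, prefers_restrict hp hc]
  rw [← h, IsUniqueWinner]
  refine ⟨fun h => by simp [h], fun h => Finset.eq_singleton_iff_unique_mem.2 ⟨h, fun c hc => ?_⟩⟩
  simp only [condorcet, Finset.mem_filter] at h hc
  by_contra hcp
  have h1 := h.2 c hc.1 hcp
  have h2 := hc.2 p h.1 (Ne.symm hcp)
  omega

theorem isUniqueWinner_approval {S : Finset ℕ} {U : List ApprovalBallot} {p : ℕ} (hp : p ∈ S) :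
    IsUniqueWinner approval S U p ↔ ∀ c ∈ S, c ≠ p →
      ahead (fun b c => if c ∈ b then 0 else 1) U c p <
        ahead (fun b c => if c ∈ b then 0 else 1) U p c := by
  rw [approval, isUniqueWinner_ofScore _ hp]
  refine forall₂_congr fun c hc => imp_congr_right fun _ => ?_
  rw [Nat.cast_lt, List.countP_map, List.countP_map]
  -- Ballots that approve of both candidates or of neither cancel, so the difference of the scores
  -- is the difference of the two one-sided counts.
  have key : U.countP ((fun b : ApprovalBallot => decide (c ∈ b)) ∘
        fun b => BallotKind.restrict b S) + ahead (fun b c => if c ∈ b then 0 else 1) U p c =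
      U.countP ((fun b : ApprovalBallot => decide (p ∈ b)) ∘
        fun b => BallotKind.restrict b S) + ahead (fun b c => if c ∈ b then 0 else 1) U c p := by
    induction U with
    | nil => rfl
    | cons b U ih =>
      simp only [ahead, List.countP_cons, Function.comp_apply, BallotKind.restrict,
        Finset.mem_inter, hc, hp, and_true] at ih ⊢
      by_cases h1 : c ∈ b <;> by_cases h2 : p ∈ b <;> simp [h1, h2] <;> omega
  omega

theorem restrict_eq_self {S : Finset ℕ} {b : PrefList} (hb : BallotKind.IsOver b S) :
    BallotKind.restrict b S = b := by
  refine List.filter_eq_self.2 fun c hc => ?_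
  simpa [← hb.2] using hc

theorem isUniqueWinner_plurality {S : Finset ℕ} {U : List PrefList} {p : ℕ} (hp : p ∈ S)
    (hU : ∀ b ∈ U, BallotKind.IsOver b S) :
    IsUniqueWinner plurality S U p ↔ ∀ c ∈ S, c ≠ p →
      (U.countP fun b => b.head? = some c) < U.countP fun b => b.head? = some p := by
  have : (U.map fun b => BallotKind.restrict b S) = U := by
    rw [List.map_congr_left fun b hb => restrict_eq_self (hU b hb), List.map_id']
  rw [plurality, isUniqueWinner_ofScore _ hp, this]
  simp only [Nat.cast_lt]

/-- A ballot has at most one head and the ranks are `0` and `1`, so to be ahead of a different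
candidate is to be first. -/
theorem ahead_top (U : List PrefList) {c p : ℕ} (hcp : c ≠ p) :
    ahead (fun b c => if b.head? = some c then 0 else 1) U c p =
      U.countP fun b => b.head? = some c := by
  refine List.countP_congr fun b _ => ?_
  by_cases h1 : b.head? = some c
  · simp [h1, hcp]
  · simp only [h1, if_false, decide_eq_true_eq, iff_false, not_lt]
    split_ifs <;> simp

theorem exists_prefList {D : Finset ℕ} {c : ℕ} (hc : c ∈ D) :
    ∃ b : PrefList, BallotKind.IsOver b D ∧ b.head? = some c ∧
      ∀ p, p ≠ c → b.idxOf c < b.idxOf p := by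
  refine ⟨c :: (D.erase c).toList, ⟨?_, ?_⟩, rfl, fun p hp => ?_⟩
  · simp [Finset.nodup_toList]
  · rw [List.toFinset_cons, Finset.toList_toFinset, Finset.insert_erase hc]
  · simp [hp.symm]

namespace ControlInstance

theorem CanReach.p_mem {B : Type} [BallotKind B] [DecidableEq B] {I : ControlInstance B}
    {S : Finset ℕ} {U : List B} (h : I.CanReach S U) : I.p ∈ S := by
  obtain ⟨A', C', V₀, W', -, -, -, hp, -, -, -, -, -, rfl, -⟩ := h
  simp [hp, I.p_mem]

theorem CanReach.isOver {B : Type} [BallotKind B] [DecidableEq B] {I : ControlInstance B}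
    {S : Finset ℕ} {U : List B} (h : I.CanReach S U) {b : B} (hb : b ∈ U) :
    BallotKind.IsOver b (I.C.toFinset ∪ I.A.toFinset) := by
  obtain ⟨A', C', V₀, W', -, -, -, -, -, -, -, -, -, -, -, -, h⟩ := h
  exact h b hb

theorem CanReach.eq_of_fixed_candidates {B : Type} [BallotKind B] [DecidableEq B]
    {I : ControlInstance B} {S : Finset ℕ} {U : List B} (h : I.CanReach S U) (hA : I.A = [])
    (hDC : I.kDC = 0) : S = I.C.toFinset := by
  obtain ⟨A', C', V₀, W', hA', -, -, -, hC', -, -, -, -, rfl, -⟩ := h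
  rw [hA] at hA'
  have h1 : A' = ∅ := by simpa using hA'
  have h2 : C' = ∅ := by simpa [hDC] using hC'
  simp [h1, h2]

theorem canReach_self {B : Type} [BallotKind B] [DecidableEq B] (I : ControlInstance B) :
    I.CanReach I.C.toFinset I.V :=
  ⟨∅, ∅, I.V, [], by simp, by simp, by simp, by simp, by simp, List.Sublist.refl _, by simp,
    List.nil_sublist _, by simp, by simp, by simp,
    by rw [List.append_nil, List.countP_zip_self]; omega, I.ballots_V⟩

end ControlInstance

theorem vulnerable_destructive {B : Type} [UniformBallotKind B] [DecidableEq B]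
    {E : ElectionSystem B} {T : Set Prong} {rank : B → ℕ → ℕ} {R : ℕ → Expr}
    (hR : ∀ I : ControlInstance B, I.RankSpec rank R)
    (hE : ∀ I : ControlInstance B, I.OfType T → ∀ S U, I.CanReach S U →
      (IsUniqueWinner E S U I.p ↔ ∀ c ∈ S, c ≠ I.p → ahead rank U c I.p < ahead rank U I.p c))
    (hrank : ∀ (D : Finset ℕ), ∀ c ∈ D, ∀ p ∈ D, c ≠ p →
      ∃ b : B, BallotKind.IsOver b D ∧ rank b c < rank b p)
    (I : ControlInstance B) (hI : I.OfType T)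
    (hwin : ∀ c ∈ I.C.toFinset, c ≠ I.p → ahead rank I.V c I.p < ahead rank I.V I.p c)
    (hbeat : I.Beatable rank) : Vulnerable E .destructive T := by
  refine ⟨⟨I, hI, not_not.2 ((hE I hI _ _ I.canReach_self).2 hwin), ?_⟩,
    decidable_destructive hR hE hrank⟩
  refine (controllable_destructive_iff (hE I hI) fun c hc hcp => hrank _ c (by simpa using hc) _
    ?_ hcp).2 hbeat
  exact List.mem_toFinset.2 (List.mem_append_left _ I.p_mem)

/-- Without voters, one spoiler candidate suffices to spoil the victory of a lone candidate. -/
def spoilerInstance (B : Type) [BallotKind B] : ControlInstance B where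
  C := [0]
  A := [1]
  V := []
  W := []
  p := 0
  kAC := 1
  kDC := 0
  kAV := 0
  kDV := 0
  kBV := 0
  nodup_C := by simp
  nodup_A := by simp
  disjoint := by simp
  ballots_V := by simp
  ballots_W := by simp
  p_mem := by simp

theorem vulnerable_destructive_of_spoiler {B : Type} [UniformBallotKind B] [DecidableEq B]
    {E : ElectionSystem B} {T : Set Prong} {rank : B → ℕ → ℕ} {R : ℕ → Expr} (hT : Prong.AC ∈ T)
    (hR : ∀ I : ControlInstance B, I.RankSpec rank R)
    (hE : ∀ S U, ∀ p ∈ S,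
      (IsUniqueWinner E S U p ↔ ∀ c ∈ S, c ≠ p → ahead rank U c p < ahead rank U p c))
    (hrank : ∀ (D : Finset ℕ), ∀ c ∈ D, ∀ p ∈ D, c ≠ p →
      ∃ b : B, BallotKind.IsOver b D ∧ rank b c < rank b p) : Vulnerable E .destructive T := by
  refine vulnerable_destructive hR (fun I _ S U h => hE S U I.p h.p_mem) hrank
    (spoilerInstance B) ?_ ?_ ⟨1, ?_, ?_, ?_, ?_⟩ <;>
  simp [ControlInstance.OfType, spoilerInstance, hT, ControlInstance.cands, ahead]

theorem vulnerable_condorcet (T : Set Prong) (hT : Prong.AC ∈ T) :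
    Vulnerable condorcet .destructive T :=
  vulnerable_destructive_of_spoiler hT rankSpec_position
    (fun _ _ _ hp => isUniqueWinner_condorcet hp) fun _ _ hc p _ hcp =>
      let ⟨b, hb, _, h⟩ := exists_prefList hc
      ⟨b, hb, h p hcp.symm⟩

theorem vulnerable_approval (T : Set Prong) (hT : Prong.AC ∈ T) :
    Vulnerable approval .destructive T :=
  vulnerable_destructive_of_spoiler hT rankSpec_disapproval
    (fun _ _ _ hp => isUniqueWinner_approval hp) fun _ c hc p _ hcp =>
      ⟨{c}, Finset.singleton_subset_iff.2 hc, by simp [hcp.symm]⟩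

theorem vulnerable_plurality_destructive :
    Vulnerable plurality .destructive {.AV, .DV, .BV} := by
  refine vulnerable_destructive rankSpec_top (fun I hI S U h => ?_) (fun D c hc p _ hcp => ?_)
    -- The only voter supports `0`; once it is deleted, both candidates have no points and `0` no
    -- longer wins alone.
    { C := [0, 1], A := [], V := [[0, 1]], W := [], p := 0, kAC := 0, kDC := 0, kAV := 0, kDV := 1,
      kBV := 0, nodup_C := by simp, nodup_A := by simp, disjoint := by simp,
      ballots_V := by simp [BallotKind.IsOver], ballots_W := by simp, p_mem := by simp }
    ?_ ?_ ⟨1, ?_, ?_, ?_, ?_⟩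
  -- First places depend on who takes part, unlike pairwise comparisons. Without candidate control
  -- the set stays `C` and restriction changes no ballot.
  · have hA := (hI.1 (by simp)).1
    have hS := h.eq_of_fixed_candidates hA (hI.2.1 (by simp))
    rw [isUniqueWinner_plurality h.p_mem]
    · refine forall₂_congr fun c _ => imp_congr_right fun hcp => ?_
      rw [ahead_top U hcp, ahead_top U (Ne.symm hcp)]
    · intro b hb
      simpa [hA, hS] using h.isOver hb
  · obtain ⟨b, hb, h, -⟩ := exists_prefList hc
    exact ⟨b, hb, by simp [h, hcp]⟩
  all_goals simp [ControlInstance.OfType, ControlInstance.cands, ahead]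

end Voting

/-! ## Constructive control of plurality elections by adding, deleting and bribing voters -/

namespace List

variable {β : Type*} [DecidableEq β]

/-- The triangle inequality for the number of differing places, used to accumulate single bribes. -/
theorem countP_zip_triangle : ∀ {l l' l'' : List β}, l'.length = l.length →
    ((l.zip l'').countP fun x => x.1 ≠ x.2) ≤
      ((l.zip l').countP fun x => x.1 ≠ x.2) + (l'.zip l'').countP fun x => x.1 ≠ x.2
  | [], _, _, _ => by simp
  | _ :: _, [], _, h => by simp at h
  | _ :: _, _ :: _, [], _ => by simp
  | a :: l, b :: l', c :: l'', h => by
    have ih := countP_zip_triangle (l := l) (l' := l') (l'' := l'') (by simpa using h)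
    rw [zip_cons_cons, zip_cons_cons, zip_cons_cons, countP_cons, countP_cons, countP_cons]
    by_cases hab : a = b
    · subst hab
      split_ifs <;> omega
    · rw [if_pos (c := decide ((a, b).1 ≠ (a, b).2) = true) (by simpa using hab)]
      split_ifs <;> omega

end List

namespace Voting

open RAM RAM.Expr

/-- The number of voters in `U` who rank `c` first. -/
def firsts (U : List PrefList) (c : ℕ) : ℕ := U.countP fun b => b.head? = some c

theorem firsts_append (U U' : List PrefList) (c : ℕ) :
    firsts (U ++ U') c = firsts U c + firsts U' c := List.countP_append ..

/-- The sets of voters counted for different candidates are disjoint, since a ballot has at most one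
head. -/
theorem sum_firsts (F : Finset ℕ) (U : List PrefList) :
    ∑ c ∈ F, firsts U c = U.countP fun b => ∃ c ∈ F, b.head? = some c := by
  induction U with
  | nil => simp [firsts]
  | cons b U ih =>
    simp only [firsts, List.countP_cons, Finset.sum_add_distrib] at ih ⊢
    rw [ih]
    congr 1
    cases b with
    | nil => simp
    | cons a b => simp

/-- The number of voters who have to turn away from the candidates in `F` if each of these
shall be ranked first at most `t` times. -/
def excess (F : Finset ℕ) (t : ℕ) (U : List PrefList) : ℕ := ∑ c ∈ F, (firsts U c - t)

/-- The excess is made up of voters of rivals, who are distinct from the supporters of `p`. So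
bribing all non-supporters covers any excess, and deleting excess voters leaves enough others to
bribe. -/
theorem excess_add_firsts_le {F : Finset ℕ} {p : ℕ} (hp : p ∉ F) (t : ℕ) (U : List PrefList) :
    excess F t U + firsts U p ≤ U.length := by
  have h : excess F t U ≤ ∑ c ∈ F, firsts U c := Finset.sum_le_sum fun c _ => Nat.sub_le _ _
  have h' : ∑ c ∈ insert p F, firsts U c ≤ U.length := by
    rw [sum_firsts]
    exact List.countP_le_length
  rw [Finset.sum_insert hp] at h'
  omega

/-- Truncation ignores candidates who gain first places. On the set `G` of the others the
subtraction is exact, and the sum counts the drop in voters whose head lies in `G`; each deletion or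
bribe lowers this number by at most one, and additions cannot lower it. -/
theorem sum_firsts_sub_le {V V₀ W' U : List PrefList} {d k : ℕ} (F : Finset ℕ)
    (hV : V₀.Sublist V) (hd : V.length ≤ V₀.length + d) (hU : U.length = (V₀ ++ W').length)
    (hk : (((V₀ ++ W').zip U).countP fun x => x.1 ≠ x.2) ≤ k) :
    ∑ c ∈ F, (firsts V c - firsts U c) ≤ d + k := by
  set G := F.filter fun c => firsts U c ≤ firsts V c with hG
  have h1 : ∑ c ∈ F, (firsts V c - firsts U c) + ∑ c ∈ G, firsts U c = ∑ c ∈ G, firsts V c := by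
    rw [← Finset.sum_filter_of_ne (p := fun c => firsts U c ≤ firsts V c)
      (fun c _ h => by omega), ← hG, ← Finset.sum_add_distrib]
    exact Finset.sum_congr rfl fun c hc => Nat.sub_add_cancel (Finset.mem_filter.1 hc).2
  rw [sum_firsts, sum_firsts] at h1
  have h2 := hV.countP_le_countP_add (fun b => ∃ c ∈ G, b.head? = some c) hd
  have h3 := List.countP_le_countP_add_zip (fun b => ∃ c ∈ G, b.head? = some c) hU
  rw [List.countP_append] at h3
  omega

theorem excess_step {F : Finset ℕ} {t h : ℕ} {U U' : List PrefList} (hF : h ∈ F)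
    (ht : t < firsts U h) (hh : firsts U' h + 1 = firsts U h)
    (hne : ∀ c ∈ F, c ≠ h → firsts U' c = firsts U c) : excess F t U' + 1 = excess F t U := by
  rw [excess, excess, ← Finset.add_sum_erase _ _ hF, ← Finset.add_sum_erase _ _ hF,
    Finset.sum_congr rfl fun c hc => by
      rw [hne c (Finset.mem_of_mem_erase hc) (Finset.ne_of_mem_erase hc)]]
  omega

theorem exists_mem_of_excess_pos {F : Finset ℕ} {t : ℕ} {U : List PrefList}
    (h : 0 < excess F t U) : ∃ b ∈ U, ∃ c ∈ F, b.head? = some c ∧ t < firsts U c := by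
  obtain ⟨c, hc, hpos⟩ := Finset.exists_ne_zero_of_sum_ne_zero h.ne'
  obtain ⟨b, hb, hbc⟩ := List.countP_pos_iff.1 (show 0 < firsts U c by omega)
  exact ⟨b, hb, c, hc, by simpa using hbc, by omega⟩

/-- As long as the excess is positive, some voter heads a rival above the threshold. Deleting this
voter costs one unit of excess and no support of `p`. -/
theorem exists_delete_excess {F : Finset ℕ} {p : ℕ} (hp : p ∉ F) (t : ℕ) (V : List PrefList) :
    ∀ j ≤ excess F t V, ∃ V₀ : List PrefList, V₀.Sublist V ∧ V.length = V₀.length + j ∧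
      firsts V₀ p = firsts V p ∧ excess F t V₀ + j = excess F t V := by
  intro j
  induction j with
  | zero => exact fun _ => ⟨V, List.Sublist.refl _, rfl, rfl, rfl⟩
  | succ j ih =>
    intro hj
    obtain ⟨V₀, h1, h2, h3, h4⟩ := ih (by omega)
    obtain ⟨b, hb, c, hc, hbc, htc⟩ := exists_mem_of_excess_pos (F := F) (t := t) (U := V₀)
      (by omega)
    obtain ⟨l, l', rfl⟩ := List.append_of_mem hb
    have hf : ∀ x, firsts (l ++ b :: l') x = firsts (l ++ l') x + if c = x then 1 else 0 := by
      intro x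
      simp [firsts, hbc, List.countP_append, List.countP_cons]
      omega
    have hcp : c ≠ p := fun h => hp (h ▸ hc)
    refine ⟨l ++ l', List.Sublist.trans (by simp) h1, by simp at h2 ⊢; omega, ?_, ?_⟩
    · rw [← h3, hf, if_neg hcp, add_zero]
    · have := excess_step (t := t) (U' := l ++ l') hc htc (by rw [hf, if_pos rfl])
        fun x _ hx => by rw [hf, if_neg hx.symm, add_zero]
      omega

/-- Each bribe takes an excess voter while there is one, and afterwards any voter who does not rank
`p` first. The hypothesis on `j` guarantees such a voter, so `p` always gains the full `j` first
places. -/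
theorem exists_bribe_excess {F : Finset ℕ} {p : ℕ} (hp : p ∉ F) (t : ℕ) {b₀ : PrefList}
    (hb₀ : b₀.head? = some p) (V : List PrefList) :
    ∀ j, j + firsts V p ≤ V.length → ∃ U : List PrefList, U.length = V.length ∧
      ((V.zip U).countP fun x => x.1 ≠ x.2) ≤ j ∧ (∀ b ∈ U, b ∈ V ∨ b = b₀) ∧
      firsts U p = firsts V p + j ∧ excess F t U ≤ excess F t V - j := by
  intro j
  induction j with
  | zero =>
    exact fun _ => ⟨V, rfl, by rw [List.countP_zip_self], fun b hb => Or.inl hb, rfl, by omega⟩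
  | succ j ih =>
    intro hj
    obtain ⟨U, h1, h2, h3, h4, h5⟩ := ih (by omega)
    have hex : ∃ b ∈ U, b.head? ≠ some p ∧
        (0 < excess F t U → ∃ c ∈ F, b.head? = some c ∧ t < firsts U c) := by
      by_cases hpos : 0 < excess F t U
      · obtain ⟨b, hb, c, hc, hbc, htc⟩ := exists_mem_of_excess_pos hpos
        refine ⟨b, hb, fun h => hp ?_, fun _ => ⟨c, hc, hbc, htc⟩⟩
        rw [hbc] at h
        rwa [← Option.some.inj h]
      · by_contra! hall
        have : firsts U p = U.length := List.countP_eq_length.2 fun b hb => by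
          by_contra hbp
          exact absurd (hall b hb (by simpa using hbp)).1 hpos
        omega
    obtain ⟨b, hb, hbp, hbF⟩ := hex
    obtain ⟨l, l', rfl⟩ := List.append_of_mem hb
    have hf : ∀ x, firsts (l ++ b :: l') x + (if x = p then 1 else 0) =
        firsts (l ++ b₀ :: l') x + if b.head? = some x then 1 else 0 := by
      intro x
      simp only [firsts, hb₀, List.countP_append, List.countP_cons, Option.some.injEq,
        decide_eq_true_eq, eq_comm (a := x)]
      omega
    refine ⟨l ++ b₀ :: l', by simpa using h1, ?_, ?_, ?_, ?_⟩
    · refine (List.countP_zip_triangle h1).trans (Nat.add_le_add h2 ?_)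
      rw [List.zip_append rfl, List.countP_append, List.countP_zip_self, List.zip_cons_cons,
        List.countP_cons, List.countP_zip_self]
      split_ifs <;> omega
    · intro x hx
      rcases List.mem_append.1 hx with hx | hx
      · exact h3 x (by simp [hx])
      · rcases List.mem_cons.1 hx with rfl | hx
        · exact Or.inr rfl
        · exact h3 x (by simp [hx])
    · have := hf p
      rw [if_pos rfl, if_neg hbp] at this
      omega
    · by_cases hpos : 0 < excess F t (l ++ b :: l')
      · obtain ⟨c, hc, hbc, htc⟩ := hbF hpos
        have hcp : c ≠ p := fun h => hp (h ▸ hc)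
        have := excess_step (t := t) (U' := l ++ b₀ :: l') hc htc
          (by simpa [hbc, hcp] using (hf c).symm)
          fun x hx hxc => by
            have hxp : x ≠ p := fun h => hp (h ▸ hx)
            simpa [hbc, hxp, hxc.symm] using (hf x).symm
        clear hbF hf
        omega
      · have : excess F t (l ++ b₀ :: l') ≤ excess F t (l ++ b :: l') := by
          refine Finset.sum_le_sum fun x hx => ?_
          have hxp : x ≠ p := fun h => hp (h ▸ hx)
          have := hf x
          rw [if_neg hxp] at this
          omega
        omega

namespace ControlInstance

variable (I : ControlInstance PrefList)

/-- The number of registered voters that are bribed to rank `p` first. -/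
def bribes : ℕ := min I.kBV (I.V.length - firsts I.V I.p)

/-- The number of voters who rank `p` first after the control action. -/
def support : ℕ := firsts I.V I.p + min I.kAV (firsts I.W I.p) + I.bribes

/-- The rivals of `p`. -/
def rivals : Finset ℕ := I.C.toFinset.filter fun c => c ≠ I.p

/-- Voter control can make `p` the unique plurality winner. -/
def Winnable : Prop :=
  I.C.length = 1 ∨ (I.support = 0 ∧ 0 < I.W.length ∧ 0 < I.kAV ∧ 0 < I.kBV) ∨
    (0 < I.support ∧ excess I.rivals (I.support - 1) I.V ≤ I.bribes + I.kDV)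

end ControlInstance

/-- Bribing a registered voter is at least as good as bribing an added one, as it can also lower the
excess. It therefore suffices to add supporters of `p` and to bribe registered voters, except when
there are no registered voters and no support at all: then one added voter has to be bribed. -/
theorem controllable_plurality_constructive_iff {I : ControlInstance PrefList} (hA : I.A = [])
    (hDC : I.kDC = 0) : Controllable plurality .constructive I ↔ I.Winnable := by
  have hwin : ∀ S U, I.CanReach S U → (IsUniqueWinner plurality S U I.p ↔
      ∀ c ∈ I.rivals, firsts U c < firsts U I.p) := by
    intro S U h
    have hS := h.eq_of_fixed_candidates hA hDC
    rw [isUniqueWinner_plurality h.p_mem fun b hb => by simpa [hA, hS] using h.isOver hb, hS]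
    simp [ControlInstance.rivals, firsts]
  have hpF : I.p ∉ I.rivals := by simp [ControlInstance.rivals]
  have hpC : I.p ∈ I.C.toFinset := List.mem_toFinset.2 I.p_mem
  constructor
  · rintro ⟨S, U, hSU, hgoal⟩
    have hgoal' : ∀ c ∈ I.rivals, firsts U c < firsts U I.p := (hwin S U hSU).1 hgoal
    obtain ⟨A', C', V₀, W', -, -, -, -, -, hV, hVk, hW, hWk, -, hlen, hdiff, -⟩ := hSU
    by_cases hC : I.C.length = 1
    · exact Or.inl hC
    obtain ⟨c, hc⟩ : ∃ c, c ∈ I.rivals := by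
      rw [← List.toFinset_card_of_nodup I.nodup_C] at hC
      by_contra! h
      refine hC (Finset.card_eq_one.2 ⟨I.p, Finset.eq_singleton_iff_unique_mem.2 ⟨hpC, ?_⟩⟩)
      intro x hx
      by_contra hxp
      exact h x (Finset.mem_filter.2 ⟨hx, hxp⟩)
    have hpos := hgoal' c hc
    have h1 : firsts U I.p ≤ firsts (V₀ ++ W') I.p + _ := List.countP_le_countP_add_zip' _ hlen
    have h2 : firsts V₀ I.p ≤ firsts I.V I.p := hV.countP_le
    have h3 : firsts W' I.p ≤ firsts I.W I.p := hW.countP_le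
    have h4 : firsts W' I.p ≤ W'.length := List.countP_le_length
    have h5 : firsts U I.p ≤ U.length := List.countP_le_length
    rw [firsts_append] at h1
    rw [List.length_append] at hlen
    have h6 := hV.length_le
    have h7 := hW.length_le
    refine Or.inr ?_
    simp only [ControlInstance.support, ControlInstance.bribes]
    by_cases hT : I.support = 0
    · simp only [ControlInstance.support, ControlInstance.bribes] at hT
      exact Or.inl ⟨hT, by omega⟩
    · refine Or.inr ⟨Nat.pos_of_ne_zero hT, ?_⟩
      simp only [ControlInstance.support, ControlInstance.bribes] at hT
      -- If the bribery limit is not capped by the supply of voters, `p` ends with at most `support`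
      -- first places, so the excess is bounded by the first places that rivals lose. Otherwise
      -- every registered non-supporter can be bribed, which covers all the excess.
      by_cases hk : I.kBV ≤ I.V.length - firsts I.V I.p
      · refine le_trans (Finset.sum_le_sum fun c hc => ?_)
          ((sum_firsts_sub_le I.rivals hV hVk (by simpa using hlen) hdiff).trans ?_)
        · have := hgoal' c hc
          omega
        · omega
      · have := excess_add_firsts_le hpF (firsts I.V I.p + min I.kAV (firsts I.W I.p) +
          min I.kBV (I.V.length - firsts I.V I.p) - 1) I.V
        omega
  · obtain ⟨b₀, hb₀, hb₀p, -⟩ := exists_prefList hpC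
    have hb₀' : BallotKind.IsOver b₀ (I.C.toFinset ∪ I.A.toFinset) := by simpa [hA] using hb₀
    have hfirst : firsts I.V I.p ≤ I.V.length := List.countP_le_length
    rintro (hC | ⟨hT, hW, hAV, hBV⟩ | ⟨hT, hle⟩)
    · refine ⟨_, _, I.canReach_self, (hwin _ _ I.canReach_self).2 fun c hc => ?_⟩
      rw [← List.toFinset_card_of_nodup I.nodup_C] at hC
      obtain ⟨hcC, hcp⟩ := Finset.mem_filter.1 hc
      exact absurd (Finset.card_le_one.1 hC.le c hcC _ hpC) hcp
    · simp only [ControlInstance.support, ControlInstance.bribes] at hT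
      -- Zero support despite a positive bribery limit means that there is no registered voter. One
      -- added voter, bribed to `b₀`, then decides the election.
      have hV : I.V = [] := List.length_eq_zero_iff.1 (by omega)
      obtain ⟨w, hw⟩ := List.length_pos_iff_exists_mem.1 hW
      have hreach : I.CanReach I.C.toFinset [b₀] := by
        refine ⟨∅, ∅, [], [w], by simp, by simp, by simp, by simp, by simp, by simp, by simp [hV],
          by simpa using hw, by simpa [Nat.one_le_iff_ne_zero, Nat.pos_iff_ne_zero] using hAV,
          by simp, by simp, ?_, by simpa using hb₀'⟩
        refine List.countP_le_length.trans ?_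
        simpa [Nat.one_le_iff_ne_zero, Nat.pos_iff_ne_zero] using hBV
      refine ⟨_, _, hreach, (hwin _ _ hreach).2 fun c hc => ?_⟩
      simp [firsts, hb₀p, (Finset.mem_filter.1 hc).2.symm]
    · have hex := excess_add_firsts_le hpF (I.support - 1) I.V
      have hB : I.bribes ≤ I.V.length - firsts I.V I.p := min_le_right _ _
      -- Only the part of the excess that the bribes cannot absorb is deleted; by `hex` enough
      -- non-supporters of `p` remain for every bribe.
      obtain ⟨V₀, hV, hVl, hVp, hVe⟩ := exists_delete_excess hpF (I.support - 1) I.V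
        (excess I.rivals (I.support - 1) I.V - I.bribes) (by omega)
      obtain ⟨V₁, hl, hdiff, hmem, hp, he⟩ := exists_bribe_excess hpF (I.support - 1) hb₀p V₀
        I.bribes (by omega)
      set Q : PrefList → Bool := fun b => b.head? = some I.p with hQ
      set W' := (I.W.filter Q).take I.kAV with hW'
      have hWQ : ∀ b ∈ W', b.head? = some I.p := fun b hb => by
        simpa [hQ] using (List.mem_filter.1 (List.mem_of_mem_take hb)).2
      have hW : W'.Sublist I.W := (List.take_sublist _ _).trans List.filter_sublist
      have hWp : firsts W' I.p = min I.kAV (firsts I.W I.p) := by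
        rw [firsts, List.countP_eq_length.2 fun b hb => by simpa using hWQ b hb, hW',
          List.length_take, firsts, List.countP_eq_length_filter]
      have hreach : I.CanReach I.C.toFinset (V₁ ++ W') := by
        refine ⟨∅, ∅, V₀, W', by simp, by simp, by simp, by simp, by simp, hV, by omega, hW,
          by simp [hW'], by simp, by simp [hl], ?_, fun b hb => ?_⟩
        · rw [List.zip_append hl.symm, List.countP_append, List.countP_zip_self, add_zero]
          exact hdiff.trans (min_le_left _ _)
        · rcases List.mem_append.1 hb with hb | hb
          · rcases hmem b hb with hb | rfl
            · exact I.ballots_V b (hV.subset hb)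
            · exact hb₀'
          · exact I.ballots_W b (hW.subset hb)
      refine ⟨_, _, hreach, (hwin _ _ hreach).2 fun c hc => ?_⟩
      have hcW : firsts W' c = 0 := List.countP_eq_zero.2 fun b hb => by
        simpa [hWQ b hb] using (Finset.mem_filter.1 hc).2.symm
      have hc0 : firsts V₁ c - (I.support - 1) ≤ excess I.rivals (I.support - 1) V₁ :=
        Finset.single_le_sum (f := fun c => firsts V₁ c - (I.support - 1))
          (fun _ _ => Nat.zero_le _) hc
      rw [firsts_append, firsts_append, hcW, hWp, hp, hVp]
      have : I.support = firsts I.V I.p + min I.kAV (firsts I.W I.p) + I.bribes := rfl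
      omega

/-! ### Evaluating the criterion for plurality -/

/-- The number of registered voters who rank the candidate `x` first. -/
def firstsV (x : ℕ) : Expr := sum 20 (cell (const 2)) (sub (const 1) (topExpr x))

/-- The number of unregistered voters who rank the candidate `x` first. -/
def firstsW (x : ℕ) : Expr :=
  sum 19 (cell (const 3)) (bind 20 (add (cell (const 2)) (var 19)) (sub (const 1) (topExpr x)))

theorem val_firstsV (I : ControlInstance PrefList) {env : ℕ → ℕ} {x : ℕ} (hx : x < 19)
    (hx' : env x ∈ I.cands) : I.val (firstsV x) env = firsts I.V (env x) := by
  rw [ControlInstance.val, firstsV, eval_sum_of_le _ _ _ _ _ _ (by simp) I.length_V_le]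
  refine List.sum_range_eq_countP _ _ _ fun k hk => ?_
  have hxk : Function.update env 20 k x = env x := Function.update_of_ne (by omega) _ _
  have h1 := rankSpec_top I (Function.update env 20 k)
    (by simp [ControlInstance.voters]; omega) x hx (by rwa [hxk])
  simp only [hxk, Function.update_self, ControlInstance.voters, List.getElem_append_left hk,
    ControlInstance.val] at h1
  by_cases h : I.V[k].head? = some (env x) <;> simp [h1, h]

theorem val_firstsW (I : ControlInstance PrefList) {env : ℕ → ℕ} {x : ℕ} (hx : x < 19)
    (hx' : env x ∈ I.cands) : I.val (firstsW x) env = firsts I.W (env x) := by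
  rw [ControlInstance.val, firstsW, eval_sum_of_le _ _ _ _ _ _ (by simp) I.length_W_le]
  refine List.sum_range_eq_countP _ _ _ fun k hk => ?_
  have hxk : Function.update (Function.update env 19 k) 20 (I.V.length + k) x = env x := by
    rw [Function.update_of_ne (by omega), Function.update_of_ne (by omega)]
  have h1 := rankSpec_top I (Function.update (Function.update env 19 k) 20 (I.V.length + k))
    (by simp [ControlInstance.voters]; omega) x hx (by rwa [hxk])
  simp only [hxk, Function.update_self, ControlInstance.voters, ControlInstance.val] at h1
  by_cases h : I.W[k].head? = some (env x) <;> simp [h1, h]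

/-- The excess of the rivals of the candidate in variable `0` over the number in variable `2`
minus `1`. -/
def excessExpr : Expr :=
  sum 3 (cell (const 0)) (bind 4 (cell (add (const 10) (var 3)))
    (ifEq (var 4) (var 0) (const 0) (sub (firstsV 4) (sub (var 2) (const 1)))))

theorem val_excessExpr (I : ControlInstance PrefList) {env : ℕ → ℕ} (h0 : env 0 = I.p) :
    I.val excessExpr env = excess I.rivals (env 2 - 1) I.V := by
  have hC : I.C.length ≤ I.cands.length := by simp [ControlInstance.cands]
  rw [excess, ControlInstance.rivals, Finset.sum_filter,
    List.sum_toFinset (fun c => if c ≠ I.p then firsts I.V c - (env 2 - 1) else 0) I.nodup_C,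
    ControlInstance.val, excessExpr,
    eval_sum_of_le _ _ _ _ _ _ (by simp) (hC.trans I.length_cands_le)]
  refine List.sum_range_eq_sum_map _ (fun c => if c ≠ I.p then firsts I.V c - (env 2 - 1) else 0) _
    fun i hi => ?_
  have hcand : I.cands[i]'(by omega) = I.C[i] := List.getElem_append_left hi
  have h1 := val_firstsV I (env := Function.update (Function.update env 3 i) 4 I.C[i]) (x := 4)
    (by omega) (by simp [ControlInstance.cands])
  simp only [ControlInstance.val, Function.update_self] at h1
  have hm : I.mem (10 + i) = I.C[i] := by rw [I.mem_cand (by omega), hcand]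
  by_cases h : I.C[i] = I.p
  · simp [hm, h, h0]
  · simp [hm, h, h0, h1]

/-- An expression that is nonzero iff voter control can make `p` the unique plurality winner. -/
def winnableExpr : Expr :=
  bind 0 (cell (const 4))
    (bind 1 (least (cell (const 9)) (sub (cell (const 2)) (firstsV 0)))
      (bind 2 (add (add (firstsV 0) (least (cell (const 7)) (firstsW 0))) (var 1))
        (ifEq (cell (const 0)) (const 1) (const 1)
          (ite (var 2) (ifLt (add (var 1) (cell (const 8))) excessExpr (const 0) (const 1))
            (ite (cell (const 3)) (ite (cell (const 7)) (ite (cell (const 9)) (const 1) (const 0))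
              (const 0)) (const 0))))))

theorem val_winnableExpr (I : ControlInstance PrefList) (env : ℕ → ℕ) :
    I.val winnableExpr env ≠ 0 ↔ I.Winnable := by
  have hp : I.p ∈ I.cands := List.mem_append_left _ I.p_mem
  set e0 := Function.update env 0 I.p with he0
  set e1 := Function.update e0 1 I.bribes with he1
  set e2 := Function.update e1 2 I.support with he2
  have v0 := val_firstsV I (env := e0) (x := 0) (by omega) (by simpa [he0])
  have v1 := val_firstsV I (env := e1) (x := 0) (by omega) (by simpa [he1, he0])
  have w1 := val_firstsW I (env := e1) (x := 0) (by omega) (by simpa [he1, he0])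
  have x2 := val_excessExpr I (env := e2) (by simp [he2, he1, he0])
  have hb : (least (cell (const 9)) (sub (cell (const 2)) (firstsV 0))).eval I.mem I.code.length
      e0 = I.bribes := by
    have : e0 0 = I.p := by simp [he0]
    simp only [ControlInstance.val, this] at v0
    simp [v0, ControlInstance.bribes]
  have hs : (add (add (firstsV 0) (least (cell (const 7)) (firstsW 0))) (var 1)).eval I.mem
      I.code.length e1 = I.support := by
    have h0 : e1 0 = I.p := by simp [he1, he0]
    have h1 : e1 1 = I.bribes := by simp [he1]
    simp only [ControlInstance.val, h0] at v1 w1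
    simp [v1, w1, h1, ControlInstance.support]
  have h0 : (cell (const 4)).eval I.mem I.code.length env = I.p := by simp
  have hx2 : e2 2 = I.support := by simp [he2]
  have hx1 : e2 1 = I.bribes := by simp [he2, he1]
  simp only [ControlInstance.val, hx2] at x2
  rw [ControlInstance.val, winnableExpr, eval_bind, h0, ← he0, eval_bind, hb, ← he1, eval_bind,
    hs, ← he2]
  simp only [eval_ifEq, eval_ifLt, eval_ite, eval_cell, eval_const, eval_var, eval_add, hx1, hx2,
    x2, I.mem_zero, I.mem_three, I.mem_seven, I.mem_eight, I.mem_nine]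
  unfold ControlInstance.Winnable
  split_ifs <;> omega

/-- A single voter ranks the preferred candidate last. -/
def lastPlaceInstance : ControlInstance PrefList where
  C := [0, 1]
  A := []
  V := [[1, 0]]
  W := []
  p := 0
  kAC := 0
  kDC := 0
  kAV := 0
  kDV := 0
  kBV := 1
  nodup_C := by simp
  nodup_A := by simp
  disjoint := by simp
  ballots_V := by simp [BallotKind.IsOver, Finset.pair_comm]
  ballots_W := by simp
  p_mem := by simp

theorem vulnerable_plurality_constructive :
    Vulnerable plurality .constructive {.AV, .DV, .BV} := by
  refine ⟨⟨lastPlaceInstance, by simp [ControlInstance.OfType, lastPlaceInstance], ?_, ?_⟩, ?_⟩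
  · change ¬ IsUniqueWinner plurality _ _ _
    rw [isUniqueWinner_plurality (by simp [lastPlaceInstance])
      (by simp [lastPlaceInstance, BallotKind.IsOver, Finset.pair_comm])]
    simp [lastPlaceInstance]
  · rw [controllable_plurality_constructive_iff rfl rfl]
    refine Or.inr (Or.inr ⟨?_, ?_⟩) <;>
    simp [ControlInstance.support, ControlInstance.bribes, ControlInstance.rivals, firsts, excess,
      lastPlaceInstance]
  · refine decidableInPolyTime_of_expr winnableExpr fun I => ?_
    exact (val_winnableExpr I.1 _).trans
      (controllable_plurality_constructive_iff (I.2.1 (by simp)).1 (I.2.2.1 (by simp))).symm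

end Voting

/-! ## Destructive control of Copeland elections by adding and deleting candidates -/

/-! ### Sums of the `k` largest values -/

section TopSum

/-- The number of indices below `n` that precede `j` when `f` is sorted in decreasing order. -/
def rankBelow (n : ℕ) (f : ℕ → ℕ) (j : ℕ) : ℕ :=
  ((Finset.range n).filter fun i => f j < f i ∨ f j = f i ∧ i < j).card

/-- The sum of the `k` largest values of `f` below `n`. -/
def topSum (n : ℕ) (f : ℕ → ℕ) (k : ℕ) : ℕ :=
  ∑ j ∈ (Finset.range n).filter fun j => rankBelow n f j < k, f j

variable {n : ℕ} {f : ℕ → ℕ}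

theorem rankBelow_lt_rankBelow {i j : ℕ} (hi : i < n) (h : f j < f i ∨ f j = f i ∧ i < j) :
    rankBelow n f i < rankBelow n f j := by
  refine Finset.card_lt_card ((Finset.ssubset_iff_of_subset fun x hx => ?_).2 ⟨i, ?_, ?_⟩)
  · simp only [Finset.mem_filter] at hx ⊢
    exact ⟨hx.1, by omega⟩
  · simp [hi, h]
  · simp

/-- Ties are broken by the index, so of two distinct indices one precedes the other and has the
smaller rank. -/
theorem injOn_rankBelow : Set.InjOn (rankBelow n f) (Finset.range n) := by
  intro i hi j hj hij
  simp only [Finset.coe_range, Set.mem_Iio] at hi hj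
  by_contra hne
  have h : (f j < f i ∨ f j = f i ∧ i < j) ∨ (f i < f j ∨ f i = f j ∧ j < i) := by omega
  rcases h with h | h
  · exact (rankBelow_lt_rankBelow hi h).ne hij
  · exact (rankBelow_lt_rankBelow hj h).ne' hij

theorem rankBelow_lt {j : ℕ} (hj : j < n) : rankBelow n f j < n := by
  have : rankBelow n f j ≤ ((Finset.range n).erase j).card :=
    Finset.card_le_card fun x hx => by
      simp only [Finset.mem_filter, Finset.mem_erase] at hx ⊢
      exact ⟨by rintro rfl; omega, hx.1⟩
  rw [Finset.card_erase_of_mem (Finset.mem_range.2 hj), Finset.card_range] at this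
  omega

theorem card_filter_rankBelow_le (k : ℕ) :
    ((Finset.range n).filter fun j => rankBelow n f j < k).card ≤ k := by
  conv_rhs => rw [← Finset.card_range k]
  refine Finset.card_le_card_of_injOn (rankBelow n f) (fun j hj => ?_) ?_
  · simpa using (Finset.mem_filter.1 hj).2
  · exact injOn_rankBelow.mono fun j hj => (Finset.mem_filter.1 hj).1

/-- Injectivity makes the ranks a permutation of the numbers below `n`, so each rank below `k` is
attained. -/
theorem le_card_filter_rankBelow {k : ℕ} (hk : k ≤ n) :
    k ≤ ((Finset.range n).filter fun j => rankBelow n f j < k).card := by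
  have himage : (Finset.range n).image (rankBelow n f) = Finset.range n := by
    refine Finset.eq_of_subset_of_card_le (fun x hx => ?_) ?_
    · obtain ⟨j, hj, rfl⟩ := Finset.mem_image.1 hx
      exact Finset.mem_range.2 (rankBelow_lt (Finset.mem_range.1 hj))
    · rw [Finset.card_image_of_injOn injOn_rankBelow]
  conv_lhs => rw [← Finset.card_range k]
  refine (Finset.card_le_card fun x hx => ?_).trans
    (Finset.card_image_le (f := rankBelow n f))
  have hxk := Finset.mem_range.1 hx
  have : x ∈ (Finset.range n).image (rankBelow n f) := by
    rw [himage]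
    exact Finset.mem_range.2 (by omega)
  obtain ⟨j, hj, rfl⟩ := Finset.mem_image.1 this
  exact Finset.mem_image_of_mem _ (Finset.mem_filter.2 ⟨hj, hxk⟩)

/-- Exchange argument: outside the common part, the selected set has at least as many elements as
`s`, and none of them has a smaller value than the best element `x` that `s` has there. -/
theorem sum_le_topSum {s : Finset ℕ} {k : ℕ} (hs : s ⊆ Finset.range n) (hk : s.card ≤ k) :
    ∑ j ∈ s, f j ≤ topSum n f k := by
  set t := (Finset.range n).filter fun j => rankBelow n f j < k with ht
  change _ ≤ ∑ j ∈ t, f j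
  rw [← Finset.sum_inter_add_sum_sdiff s t, ← Finset.sum_inter_add_sum_sdiff t s,
    Finset.inter_comm t s]
  refine Nat.add_le_add_left ?_ _
  rcases (s \ t).eq_empty_or_nonempty with h | h
  · simp [h]
  obtain ⟨x, hx, hmax⟩ := Finset.exists_max_image _ f h
  obtain ⟨hxs, hxt⟩ := Finset.mem_sdiff.1 hx
  have hxn := Finset.mem_range.1 (hs hxs)
  have hkx : k ≤ rankBelow n f x := by
    by_contra hlt
    exact hxt (Finset.mem_filter.2 ⟨hs hxs, by omega⟩)
  have hkn : k ≤ n := hkx.trans (rankBelow_lt hxn).le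
  have hcard : (s \ t).card ≤ (t \ s).card := by
    have h1 := Finset.card_sdiff_add_card_inter s t
    have h2 := Finset.card_sdiff_add_card_inter t s
    have h3 := le_card_filter_rankBelow (f := f) hkn
    rw [Finset.inter_comm] at h2
    rw [← ht] at h3
    omega
  calc ∑ j ∈ s \ t, f j ≤ (s \ t).card * f x := by
        simpa using Finset.sum_le_card_nsmul _ _ _ hmax
    _ ≤ (t \ s).card * f x := Nat.mul_le_mul_right _ hcard
    _ ≤ ∑ j ∈ t \ s, f j := by
        rw [← smul_eq_mul]
        refine Finset.card_nsmul_le_sum _ _ _ fun y hy => ?_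
        obtain ⟨hyt, hys⟩ := Finset.mem_sdiff.1 hy
        by_contra hlt
        have := rankBelow_lt_rankBelow (f := f) hxn (Or.inl (show f y < f x by omega))
        have := (Finset.mem_filter.1 hyt).2
        omega

/-- The sum of the `k` largest values of `g` on a list. -/
def List.topSum (l : List ℕ) (g : ℕ → ℕ) (k : ℕ) : ℕ :=
  _root_.topSum l.length (fun j => g (l.getD j 0)) k

theorem List.sum_le_topSum {l : List ℕ} {g : ℕ → ℕ} {k : ℕ} {s : Finset ℕ}
    (hs : s ⊆ l.toFinset) (hk : s.card ≤ k) : ∑ x ∈ s, g x ≤ l.topSum g k := by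
  have hidx : ∀ x ∈ s, l.idxOf x < l.length := fun x hx =>
    List.idxOf_lt_length_iff.2 (List.mem_toFinset.1 (hs hx))
  have hget : ∀ x ∈ s, l.getD (l.idxOf x) 0 = x := fun x hx => by
    rw [List.getD_eq_getElem _ _ (hidx x hx), List.getElem_idxOf]
  have : ∑ x ∈ s, g x = ∑ j ∈ s.image l.idxOf, g (l.getD j 0) := by
    rw [Finset.sum_image fun x hx y hy h => by rw [← hget x hx, h, hget y hy]]
    exact Finset.sum_congr rfl fun x hx => by rw [hget x hx]
  rw [this]
  refine _root_.sum_le_topSum (f := fun j => g (l.getD j 0)) (fun j hj => ?_)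
    (Finset.card_image_le.trans hk)
  obtain ⟨x, hx, rfl⟩ := Finset.mem_image.1 hj
  exact Finset.mem_range.2 (hidx x hx)

/-- Selected elements of value zero are dropped, which does not affect the sum. This later keeps `p`
and `c`, whose gain is zero by definition, out of the sets of deleted and added candidates. -/
theorem List.exists_sum_eq_topSum {l : List ℕ} (hl : l.Nodup) (g : ℕ → ℕ) (k : ℕ) :
    ∃ s ⊆ l.toFinset, s.card ≤ k ∧ (∀ x ∈ s, g x ≠ 0) ∧ ∑ x ∈ s, g x = l.topSum g k := by
  set t := (Finset.range l.length).filter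
    fun j => rankBelow l.length (fun j => g (l.getD j 0)) j < k with ht
  have hlt : ∀ j ∈ t, j < l.length := fun j hj => Finset.mem_range.1 (Finset.mem_filter.1 hj).1
  refine ⟨(t.image fun j => l.getD j 0).filter fun x => g x ≠ 0, fun x hx => ?_, ?_,
    fun x hx => (Finset.mem_filter.1 hx).2, ?_⟩
  · obtain ⟨j, hj, rfl⟩ := Finset.mem_image.1 (Finset.mem_filter.1 hx).1
    rw [List.getD_eq_getElem _ _ (hlt j hj)]
    simp
  · exact (Finset.card_filter_le _ _).trans (Finset.card_image_le.trans
      (card_filter_rankBelow_le k))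
  · rw [Finset.sum_filter_ne_zero, Finset.sum_image]
    · rfl
    · intro i hi j hj hij
      simp only [List.getD_eq_getElem _ _ (hlt i hi), List.getD_eq_getElem _ _ (hlt j hj)] at hij
      exact (hl.getElem_inj_iff).1 hij

end TopSum

/-! ### Copeland points as natural numbers and the criterion for candidate control -/

namespace Voting

open RAM RAM.Expr

/-- The points of `c` against `c'` among the voters `V`, when a victory counts `b` and a tie
counts `a`. -/
def duel (a b : ℕ) (V : List PrefList) (c c' : ℕ) : ℕ :=
  if ahead (fun b c => b.idxOf c) V c' c < ahead (fun b c => b.idxOf c) V c c' then b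
  else if ahead (fun b c => b.idxOf c) V c c' = ahead (fun b c => b.idxOf c) V c' c then a else 0

/-- Multiplication of all scores by `b > 0` preserves their order and turns `1` and `a / b` into `b`
and `a`. -/
theorem isUniqueWinner_copeland {a b : ℕ} (hb : 0 < b) {S : Finset ℕ} {U : List PrefList} {p : ℕ}
    (hp : p ∈ S) : IsUniqueWinner (copeland (a / b)) S U p ↔ ∀ c ∈ S, c ≠ p →
      ∑ d ∈ S.erase c, duel a b U c d < ∑ d ∈ S.erase p, duel a b U p d := by
  rw [copeland, isUniqueWinner_ofScore _ hp]
  have hb' : (0 : ℚ) < b := by exact_mod_cast hb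
  have key : ∀ c ∈ S, (∑ d ∈ S.erase c,
      if prefers (U.map fun b => BallotKind.restrict b S) d c <
        prefers (U.map fun b => BallotKind.restrict b S) c d then (1 : ℚ)
      else if prefers (U.map fun b => BallotKind.restrict b S) c d =
        prefers (U.map fun b => BallotKind.restrict b S) d c then (a / b : ℚ)
      else 0) * b = ((∑ d ∈ S.erase c, duel a b U c d : ℕ) : ℚ) := by
    intro c hc
    rw [Finset.sum_mul, Nat.cast_sum]
    refine Finset.sum_congr rfl fun d hd => ?_
    have hd := Finset.mem_of_mem_erase hd
    rw [prefers_restrict hc hd, prefers_restrict hd hc, duel]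
    split_ifs
    · simp
    · rw [div_mul_cancel₀ _ hb'.ne']
    · simp
  refine forall₂_congr fun c hc => imp_congr_right fun _ => ?_
  rw [← Nat.cast_lt (α := ℚ), ← key c hc, ← key p hp]
  exact (mul_lt_mul_iff_left₀ hb').symm

theorem canReach_eq_of_fixed_voters {B : Type} [BallotKind B] [DecidableEq B]
    {I : ControlInstance B} {S : Finset ℕ} {U : List B} (h : I.CanReach S U) (hW : I.W = [])
    (hDV : I.kDV = 0) (hBV : I.kBV = 0) : U = I.V := by
  obtain ⟨A', C', V₀, W', -, -, -, -, -, hV, hVk, hW', -, -, hlen, hdiff, -⟩ := h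
  rw [hW, List.sublist_nil] at hW'
  subst hW'
  have hV₀ := hV.eq_of_length_le (by omega)
  subst hV₀
  rw [List.append_nil] at hlen hdiff
  rw [hBV, Nat.le_zero, List.countP_eq_zero] at hdiff
  refine List.ext_getElem hlen fun i h1 h2 => ?_
  have := hdiff (I.V[i], U[i]) (List.mem_iff_getElem.2 ⟨i, by simp [h1, h2], by simp⟩)
  simpa using Eq.symm (a := I.V[i]) (b := U[i]) (by simpa using this)

/-- The gain of `c` on `p` when the candidate `d` joins the election. -/
def gain (h : ℕ → ℕ → ℕ) (p c d : ℕ) : ℕ := if d = p ∨ d = c then 0 else h c d - h p d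

namespace ControlInstance

variable {B : Type} [BallotKind B] (I : ControlInstance B)

/-- The candidates in `C` apart from `p` and `c`. -/
def others (c : ℕ) : Finset ℕ := I.C.toFinset.filter fun d => d ≠ I.p ∧ d ≠ c

/-- Candidate control enables `c` to gain as many points as `p` has, where `h c d` is the number
of points of `c` against `d`. -/
def Overtakes (h : ℕ → ℕ → ℕ) (c : ℕ) : Prop :=
  h I.p c + ∑ d ∈ I.others c, h I.p d ≤
    h c I.p + ∑ d ∈ I.others c, h c d + I.C.topSum (gain h c I.p) I.kDC +
      I.A.topSum (gain h I.p c) (if c ∈ I.C then I.kAC else I.kAC - 1)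

variable {I}

/-- Apart from their mutual contest, `c` and `p` meet the same opponents: the surviving other
members of `C` and the added spoilers except `c`. -/
theorem sum_duels {A' C' : Finset ℕ} {c : ℕ} (hA : A' ⊆ I.A.toFinset) (hp : I.p ∉ C')
    (hcp : c ≠ I.p) (hc : c ∈ I.C.toFinset \ C' ∪ A') (h : ℕ → ℕ → ℕ) :
    ∑ d ∈ (I.C.toFinset \ C' ∪ A').erase I.p, h I.p d =
        h I.p c + (∑ d ∈ I.others c \ C', h I.p d + ∑ d ∈ A'.erase c, h I.p d) ∧
      ∑ d ∈ (I.C.toFinset \ C' ∪ A').erase c, h c d =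
        h c I.p + (∑ d ∈ I.others c \ C', h c d + ∑ d ∈ A'.erase c, h c d) := by
  have hpA : I.p ∉ A' := fun h => I.disjoint I.p_mem (List.mem_toFinset.1 (hA h))
  have hdisj : Disjoint (I.others c \ C') (A'.erase c) := by
    rw [Finset.disjoint_left]
    intro d hd hd'
    simp only [others, Finset.mem_sdiff, Finset.mem_filter, List.mem_toFinset] at hd
    exact I.disjoint hd.1.1 (List.mem_toFinset.1 (hA (Finset.mem_of_mem_erase hd')))
  have hset : ((I.C.toFinset \ C' ∪ A').erase I.p).erase c =
      (I.others c \ C') ∪ A'.erase c := by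
    ext d
    simp only [others, Finset.mem_erase, Finset.mem_union, Finset.mem_sdiff, Finset.mem_filter]
    constructor
    · tauto
    · rintro (h | h)
      · tauto
      · exact ⟨h.1, fun hd => hpA (hd ▸ h.2), Or.inr h.2⟩
  have hpS : I.p ∈ I.C.toFinset \ C' ∪ A' := by simp [hp, I.p_mem]
  constructor
  · rw [← Finset.add_sum_erase _ _ (Finset.mem_erase.2 ⟨hcp, hc⟩), hset,
      Finset.sum_union hdisj]
  · rw [← Finset.add_sum_erase _ _ (Finset.mem_erase.2 ⟨hcp.symm, hpS⟩), Finset.erase_right_comm,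
      hset, Finset.sum_union hdisj]

end ControlInstance

/-- For fixed `c` the difference of the two scores is a sum of independent contributions of the
third candidates. The best attack deletes those with the largest gain of `p` on `c` and adds those
with the largest gain of `c` on `p`. -/
theorem controllable_copeland_iff {a b : ℕ} (hb : 0 < b) {I : ControlInstance PrefList}
    (hW : I.W = []) (hDV : I.kDV = 0) (hBV : I.kBV = 0) :
    Controllable (copeland (a / b)) .destructive I ↔
      ∃ c ∈ I.cands, c ≠ I.p ∧ (c ∈ I.C ∨ 0 < I.kAC) ∧ I.Overtakes (duel a b I.V) c := by
  set h := duel a b I.V with hh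
  constructor
  · rintro ⟨S, U, hSU, hgoal⟩
    have hgoal' : ¬ IsUniqueWinner (copeland (a / b)) S U I.p := hgoal
    rw [isUniqueWinner_copeland hb hSU.p_mem, canReach_eq_of_fixed_voters hSU hW hDV hBV, ← hh]
      at hgoal'
    push Not at hgoal'
    obtain ⟨c, hc, hcp, hle⟩ := hgoal'
    obtain ⟨A', C', V₀, W', hA, hAk, hC, hp, hCk, -, -, -, -, rfl, -⟩ := hSU
    have hc' : c ∈ I.C ∨ c ∈ A' := by
      rcases Finset.mem_union.1 hc with hc | hc
      · exact Or.inl (List.mem_toFinset.1 (Finset.mem_sdiff.1 hc).1)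
      · exact Or.inr hc
    refine ⟨c, ?_, hcp, hc'.imp_right fun hc => (Finset.card_pos.2 ⟨c, hc⟩).trans_le hAk, ?_⟩
    · rw [ControlInstance.cands, List.mem_append]
      exact hc'.imp_right fun hc => List.mem_toFinset.1 (hA hc)
    have h1 : ∑ d ∈ I.others c ∩ C', gain h c I.p d ≤ I.C.topSum (gain h c I.p) I.kDC :=
      List.sum_le_topSum (fun d hd => hC (Finset.mem_inter.1 hd).2)
        ((Finset.card_le_card Finset.inter_subset_right).trans hCk)
    have h2 : ∑ d ∈ A'.erase c, gain h I.p c d ≤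
        I.A.topSum (gain h I.p c) (if c ∈ I.C then I.kAC else I.kAC - 1) := by
      -- If `c` is itself a spoiler, its own addition uses up one unit of the limit.
      refine List.sum_le_topSum ((Finset.erase_subset _ _).trans hA) ?_
      split_ifs with hcC
      · exact Finset.card_erase_le.trans hAk
      · rw [Finset.card_erase_of_mem (hc'.resolve_left hcC)]
        omega
    have h3 : ∑ d ∈ I.others c ∩ C', h I.p d ≤
        ∑ d ∈ I.others c ∩ C', h c d + ∑ d ∈ I.others c ∩ C', gain h c I.p d := by
      rw [← Finset.sum_add_distrib]
      refine Finset.sum_le_sum fun d hd => ?_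
      have := (Finset.mem_filter.1 (Finset.mem_inter.1 hd).1).2
      rw [gain, if_neg (by tauto)]
      omega
    have h4 : ∑ d ∈ A'.erase c, h c d ≤
        ∑ d ∈ A'.erase c, h I.p d + ∑ d ∈ A'.erase c, gain h I.p c d := by
      rw [← Finset.sum_add_distrib]
      refine Finset.sum_le_sum fun d hd => ?_
      have hdc := Finset.ne_of_mem_erase hd
      have hdp : d ≠ I.p := fun hd' => I.disjoint I.p_mem
        (List.mem_toFinset.1 (hA (hd' ▸ Finset.mem_of_mem_erase hd)))
      rw [gain, if_neg (by tauto)]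
      omega
    obtain ⟨h5, h6⟩ := ControlInstance.sum_duels hA hp hcp hc h
    rw [h5, h6] at hle
    have h7 := Finset.sum_inter_add_sum_sdiff (I.others c) C' (h I.p)
    have h8 := Finset.sum_inter_add_sum_sdiff (I.others c) C' (h c)
    rw [ControlInstance.Overtakes]
    omega
  · rintro ⟨c, hc, hcp, hcA, hle⟩
    obtain ⟨C', hC, hCk, hC0, hCs⟩ := List.exists_sum_eq_topSum I.nodup_C (gain h c I.p) I.kDC
    obtain ⟨A₀, hA, hAk, hA0, hAs⟩ := List.exists_sum_eq_topSum I.nodup_A (gain h I.p c)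
      (if c ∈ I.C then I.kAC else I.kAC - 1)
    have hCne : ∀ d ∈ C', d ≠ I.p ∧ d ≠ c := fun d hd => by
      have := hC0 d hd
      rw [gain] at this
      by_contra hne
      exact this (if_pos (by tauto))
    have hAne : ∀ d ∈ A₀, d ≠ I.p ∧ d ≠ c := fun d hd => by
      have := hA0 d hd
      rw [gain] at this
      by_contra hne
      exact this (if_pos (by tauto))
    set A' := A₀ ∪ (if c ∈ I.C then ∅ else {c}) with hA'
    have hA'e : A'.erase c = A₀ := by
      ext d
      have := hAne d
      rw [hA']
      split_ifs <;> simp only [Finset.mem_erase, Finset.mem_union, Finset.notMem_empty,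
        Finset.mem_singleton] <;> tauto
    have hA's : A' ⊆ I.A.toFinset := by
      rw [hA']
      split_ifs with hcC
      · simpa using hA
      · refine Finset.union_subset hA (Finset.singleton_subset_iff.2 (List.mem_toFinset.2 ?_))
        exact (List.mem_append.1 hc).resolve_left hcC
    have hA'k : A'.card ≤ I.kAC := by
      rw [hA']
      split_ifs at hAk ⊢ with hcC
      · simpa using hAk
      · have := hcA.resolve_left hcC
        exact (Finset.card_union_le _ _).trans (by simp; omega)
    have hp : I.p ∉ C' := fun hp => (hCne _ hp).1 rfl
    have hcS : c ∈ I.C.toFinset \ C' ∪ A' := by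
      by_cases hcC : c ∈ I.C
      · have : c ∉ C' := fun h => (hCne c h).2 rfl
        simp [hcC, this]
      · simp [hA', hcC]
    have hreach : I.CanReach (I.C.toFinset \ C' ∪ A') I.V :=
      ⟨A', C', I.V, [], hA's, hA'k, hC, hp, hCk, List.Sublist.refl _, by simp, List.nil_sublist _,
        by simp, rfl, by simp, by rw [List.append_nil, List.countP_zip_self]; omega, I.ballots_V⟩
    refine ⟨_, _, hreach, ?_⟩
    change ¬ IsUniqueWinner _ _ _ _
    rw [isUniqueWinner_copeland hb hreach.p_mem, ← hh]
    intro hall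
    have hlt := hall c hcS hcp
    obtain ⟨h5, h6⟩ := ControlInstance.sum_duels hA's hp hcp hcS h
    rw [h5, h6, hA'e] at hlt
    have hCo : I.others c ∩ C' = C' := by
      refine Finset.inter_eq_right.2 fun d hd => Finset.mem_filter.2 ⟨hC hd, hCne d hd⟩
    have h7 := Finset.sum_inter_add_sum_sdiff (I.others c) C' (h I.p)
    have h8 := Finset.sum_inter_add_sum_sdiff (I.others c) C' (h c)
    rw [hCo] at h7 h8
    -- Chosen candidates have nonzero gain, so the truncated subtraction is exact and the earlier
    -- inequality becomes an equality.
    have h3 : ∑ d ∈ C', h I.p d = ∑ d ∈ C', h c d + ∑ d ∈ C', gain h c I.p d := by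
      rw [← Finset.sum_add_distrib]
      refine Finset.sum_congr rfl fun d hd => ?_
      have h0 := hC0 d hd
      rw [gain, if_neg (by have := hCne d hd; tauto)] at h0 ⊢
      omega
    have h4 : ∑ d ∈ A₀, h c d = ∑ d ∈ A₀, h I.p d + ∑ d ∈ A₀, gain h I.p c d := by
      rw [← Finset.sum_add_distrib]
      refine Finset.sum_congr rfl fun d hd => ?_
      have h0 := hA0 d hd
      rw [gain, if_neg (by have := hAne d hd; tauto)] at h0 ⊢
      omega
    rw [ControlInstance.Overtakes] at hle
    omega

end Voting

/-! ## An algorithm for candidate control of Copeland elections -/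

namespace Voting

open RAM RAM.Expr

/-- The sum of the `k` largest values of `g` on the list of the `n` numbers in the memory from
the address `off` on. -/
def topSumExpr (g : ℕ → Expr) (off n k : Expr) : Expr :=
  sum 3 n (bind 4 (cell (add off (var 3)))
    (ifLt (sum 5 n (bind 6 (cell (add off (var 5))) (ifLt (g 4) (g 6) (const 1)
      (ifEq (g 4) (g 6) (ifLt (var 5) (var 3) (const 1) (const 0)) (const 0)))))
      k (g 4) (const 0)))

/-- The two nested loops rebind the variables `3` to `6`, so the environment hypotheses fix only the
variables that must survive: `0` and `2` for the gain, `1` for the limit. -/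
theorem val_topSumExpr (I : ControlInstance PrefList) {l : List ℕ} (hl : l.length ≤ I.code.length)
    {g : ℕ → Expr} {off n k : Expr} {G : ℕ → ℕ} {K : ℕ} (env : ℕ → ℕ)
    (hg : ∀ env' : ℕ → ℕ, env' 0 = env 0 → env' 2 = env 2 → ∀ x < 19, env' x ∈ l →
      I.val (g x) env' = G (env' x))
    (hn : ∀ env', I.val n env' = l.length)
    (hoff : ∀ env' i (hi : i < l.length), I.mem (I.val off env' + i) = l[i])
    (hk : ∀ env' : ℕ → ℕ, env' 1 = env 1 → I.val k env' = K) :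
    I.val (topSumExpr g off n k) env = l.topSum G K := by
  rw [ControlInstance.val, topSumExpr, eval_sum_of_le _ _ _ _ _ _ (hn _) hl, List.topSum, topSum,
    Finset.sum_filter]
  refine Finset.sum_congr rfl fun j hj => ?_
  have hj := Finset.mem_range.1 hj
  have hoff' : (cell (add off (var 3))).eval I.mem I.code.length (Function.update env 3 j) =
      l[j] := by
    rw [← hoff (Function.update env 3 j) j hj]
    simp
  rw [eval_bind, hoff']
  set e := Function.update (Function.update env 3 j) 4 l[j] with he
  have e0 : e 0 = env 0 := by simp [he]
  have e1 : e 1 = env 1 := by simp [he]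
  have e2 : e 2 = env 2 := by simp [he]
  have e3 : e 3 = j := by simp [he]
  have e4 : e 4 = l[j] := by simp [he]
  have hrank : (sum 5 n (bind 6 (cell (add off (var 5))) (ifLt (g 4) (g 6) (const 1)
      (ifEq (g 4) (g 6) (ifLt (var 5) (var 3) (const 1) (const 0)) (const 0))))).eval I.mem
      I.code.length e = rankBelow l.length (fun j => G (l.getD j 0)) j := by
    rw [eval_sum_of_le _ _ _ _ _ _ (hn _) hl, rankBelow, Finset.card_filter]
    refine Finset.sum_congr rfl fun i hi => ?_
    have hi := Finset.mem_range.1 hi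
    have hoff' : (cell (add off (var 5))).eval I.mem I.code.length (Function.update e 5 i) =
        l[i] := by
      rw [← hoff (Function.update e 5 i) i hi]
      simp
    rw [eval_bind, hoff']
    set e' := Function.update (Function.update e 5 i) 6 l[i] with he'
    have h4 := hg e' (by simpa [he'] using e0) (by simpa [he'] using e2) 4 (by omega)
      (by simp [he', e4])
    have h6 := hg e' (by simpa [he'] using e0) (by simpa [he'] using e2) 6 (by omega)
      (by simp [he'])
    have e4' : e' 4 = l[j] := by simp [he', e4]
    have e6' : e' 6 = l[i] := by simp [he']
    have e3' : e' 3 = j := by simp [he', e3]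
    have e5' : e' 5 = i := by simp [he']
    rw [e4'] at h4
    rw [e6'] at h6
    simp only [ControlInstance.val] at h4 h6
    simp only [eval_ifLt, eval_ifEq, eval_var, eval_const, h4, h6, e3', e5',
      List.getD_eq_getElem _ _ hi, List.getD_eq_getElem _ _ hj]
    split_ifs <;> first | rfl | omega
  have hg4 := hg e e0 e2 4 (by omega) (by simp [e4])
  have hk' := hk e e1
  rw [e4] at hg4
  simp only [ControlInstance.val] at hg4 hk'
  rw [eval_ifLt, hrank, hk', hg4, eval_const, List.getD_eq_getElem _ _ hj]

/-- The points of the candidate `x` against the candidate `y`. -/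
def duelExpr (a b x y : ℕ) : Expr :=
  ifLt (countV positionExpr y x) (countV positionExpr x y) (const b)
    (ifEq (countV positionExpr x y) (countV positionExpr y x) (const a) (const 0))

theorem val_duelExpr (I : ControlInstance PrefList) (a b : ℕ) {env : ℕ → ℕ} {x y : ℕ} (hx : x < 19)
    (hy : y < 19) (hx' : env x ∈ I.cands) (hy' : env y ∈ I.cands) :
    I.val (duelExpr a b x y) env = duel a b I.V (env x) (env y) := by
  have h1 := (rankSpec_position I).val_countV hx hy hx' hy'
  have h2 := (rankSpec_position I).val_countV hy hx hy' hx'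
  simp only [ControlInstance.val] at h1 h2
  simp only [ControlInstance.val, duelExpr, duel, eval_ifLt, eval_ifEq, eval_const, h1, h2]

/-- The gain of the candidate `c` on the candidate `p` when the candidate `d` joins. -/
def gainExpr (a b p c d : ℕ) : Expr :=
  ifEq (var d) (var p) (const 0) (ifEq (var d) (var c) (const 0)
    (sub (duelExpr a b c d) (duelExpr a b p d)))

theorem val_gainExpr (I : ControlInstance PrefList) (a b : ℕ) {env : ℕ → ℕ} {p c d : ℕ}
    (hp : p < 19) (hc : c < 19) (hd : d < 19) (hp' : env p ∈ I.cands) (hc' : env c ∈ I.cands)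
    (hd' : env d ∈ I.cands) :
    I.val (gainExpr a b p c d) env = gain (duel a b I.V) (env p) (env c) (env d) := by
  have h1 := val_duelExpr I a b hc hd hc' hd'
  have h2 := val_duelExpr I a b hp hd hp' hd'
  simp only [ControlInstance.val] at h1 h2
  simp only [ControlInstance.val, gainExpr, gain, eval_ifEq, eval_sub, eval_const, eval_var, h1, h2]
  by_cases hdp : env d = env p
  · rw [if_pos hdp, if_pos (Or.inl hdp)]
  · by_cases hdc : env d = env c
    · rw [if_neg hdp, if_pos hdc, if_pos (Or.inr hdc)]
    · rw [if_neg hdp, if_neg hdc, if_neg (by tauto)]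

/-- The points of the candidate `x` against the candidates apart from those in the variables `0`
and `2`. -/
def othersSumExpr (a b x : ℕ) : Expr :=
  sum 3 (cell (const 0)) (bind 4 (cell (add (const 10) (var 3)))
    (ifEq (var 4) (var 0) (const 0) (ifEq (var 4) (var 2) (const 0) (duelExpr a b x 4))))

theorem mem_qualified (I : ControlInstance PrefList) {i : ℕ} (hi : i < I.C.length) :
    I.mem (10 + i) = I.C[i] := by
  rw [I.mem_cand (by simp [ControlInstance.cands]; omega)]
  exact List.getElem_append_left hi

theorem mem_spoiler (I : ControlInstance PrefList) {i : ℕ} (hi : i < I.A.length) :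
    I.mem (10 + I.C.length + i) = I.A[i] := by
  rw [add_assoc, I.mem_cand (by simp [ControlInstance.cands]; omega)]
  simp [ControlInstance.cands]

theorem val_othersSumExpr (I : ControlInstance PrefList) (a b : ℕ) {env : ℕ → ℕ} {x : ℕ}
    (hx : x < 3) (hx' : env x ∈ I.cands) (h0 : env 0 = I.p) :
    I.val (othersSumExpr a b x) env =
      ∑ d ∈ I.others (env 2), duel a b I.V (env x) d := by
  have hC : I.C.length ≤ I.cands.length := by simp [ControlInstance.cands]
  rw [ControlInstance.others, Finset.sum_filter,
    List.sum_toFinset (fun d => if d ≠ I.p ∧ d ≠ env 2 then duel a b I.V (env x) d else 0)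
      I.nodup_C, ControlInstance.val, othersSumExpr,
    eval_sum_of_le _ _ _ _ _ _ (by simp) (hC.trans I.length_cands_le)]
  refine List.sum_range_eq_sum_map _
    (fun d => if d ≠ I.p ∧ d ≠ env 2 then duel a b I.V (env x) d else 0) _ fun i hi => ?_
  set e := Function.update (Function.update env 3 i) 4 I.C[i] with he
  have ex : e x = env x := by
    rw [he, Function.update_of_ne (by omega), Function.update_of_ne (by omega)]
  have e0 : e 0 = I.p := by simpa [he] using h0
  have e2 : e 2 = env 2 := by simp [he]
  have e4 : e 4 = I.C[i] := by simp [he]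
  have h1 := val_duelExpr I a b (env := e) (x := x) (y := 4) (by omega) (by omega) (by rwa [ex])
    (by simp [e4, ControlInstance.cands])
  simp only [ControlInstance.val, ex, e4] at h1
  have hcell : (cell (add (const 10) (var 3))).eval I.mem I.code.length (Function.update env 3 i) =
      I.C[i] := by simp [mem_qualified I hi]
  rw [eval_bind, hcell, ← he]
  simp only [eval_ifEq, eval_var, eval_const, h1, e0, e2, e4]
  by_cases hdp : I.C[i] = I.p
  · rw [if_pos hdp, if_neg (by tauto)]
  · by_cases hdc : I.C[i] = env 2
    · rw [if_neg hdp, if_pos hdc, if_neg (by tauto)]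
    · rw [if_neg hdp, if_neg hdc, if_pos ⟨hdp, hdc⟩]

/-- An expression that is nonzero iff the candidate in variable `2`, whose index is in variable
`1`, can overtake the candidate in variable `0`. -/
def overtakesExpr (a b : ℕ) : Expr :=
  ifLt (add (add (add (duelExpr a b 2 0) (othersSumExpr a b 2))
      (topSumExpr (gainExpr a b 2 0) (const 10) (cell (const 0)) (cell (const 6))))
      (topSumExpr (gainExpr a b 0 2) (add (const 10) (cell (const 0))) (cell (const 1))
        (ifLt (var 1) (cell (const 0)) (cell (const 5)) (sub (cell (const 5)) (const 1)))))
    (add (duelExpr a b 0 2) (othersSumExpr a b 0)) (const 0) (const 1)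

theorem val_overtakesExpr (I : ControlInstance PrefList) (a b : ℕ) {env : ℕ → ℕ}
    (h : env 1 < I.cands.length) (h0 : env 0 = I.p) (h2 : env 2 = I.cands[env 1]) :
    I.val (overtakesExpr a b) env ≠ 0 ↔ I.Overtakes (duel a b I.V) (env 2) := by
  have hp : env 0 ∈ I.cands := h0 ▸ List.mem_append_left _ I.p_mem
  have hc : env 2 ∈ I.cands := h2 ▸ List.getElem_mem h
  have hlen : I.C.length + I.A.length ≤ I.code.length := by
    simpa [ControlInstance.cands] using I.length_cands_le
  have v1 := val_duelExpr I a b (x := 2) (y := 0) (by omega) (by omega) hc hp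
  have v2 := val_duelExpr I a b (x := 0) (y := 2) (by omega) (by omega) hp hc
  have v3 := val_othersSumExpr I a b (x := 2) (by omega) hc h0
  have v4 := val_othersSumExpr I a b (x := 0) (by omega) hp h0
  -- Deleting `d` reverses the effect of `d` joining, so `p` and `c` swap roles in the gain.
  have v5 := val_topSumExpr I (l := I.C) (by omega) (g := gainExpr a b 2 0) (off := const 10)
    (n := cell (const 0)) (k := cell (const 6)) (G := gain (duel a b I.V) (env 2) (env 0))
    (K := I.kDC) env
    (fun env' e0 e2 x hx hm => by
      rw [val_gainExpr I a b (by omega) (by omega) hx (by rwa [e2]) (by rwa [e0])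
        (List.mem_append_left _ hm), e0, e2])
    (fun _ => by simp) (fun env' i hi => by simp [mem_qualified I hi]) (fun _ _ => by simp)
  have v6 := val_topSumExpr I (l := I.A) (by omega) (g := gainExpr a b 0 2)
    (off := add (const 10) (cell (const 0)))
    (n := cell (const 1))
    (k := ifLt (var 1) (cell (const 0)) (cell (const 5)) (sub (cell (const 5)) (const 1)))
    (G := gain (duel a b I.V) (env 0) (env 2)) (K := if env 2 ∈ I.C then I.kAC else I.kAC - 1) env
    (fun env' e0 e2 x hx hm => by
      rw [val_gainExpr I a b (by omega) (by omega) hx (by rwa [e0]) (by rwa [e2])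
        (List.mem_append_right _ hm), e0, e2])
    (fun _ => by simp) (fun env' i hi => by simp [mem_spoiler I hi])
    (fun env' e1 => by simp [e1, h2, I.getElem_cands_mem_iff])
  rw [h0] at v1 v2 v4 v5 v6
  simp only [ControlInstance.val] at v1 v2 v3 v4 v5 v6
  rw [ControlInstance.val, overtakesExpr, eval_ifLt]
  simp only [eval_add, v1, v2, v3, v4, v5, v6, eval_const, ControlInstance.Overtakes]
  split_ifs <;> omega

theorem vulnerable_copeland {α : ℚ} (hα : 0 ≤ α) :
    Vulnerable (copeland α) .destructive {.AC, .DC} := by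
  obtain ⟨a, b, hb, rfl⟩ : ∃ a b : ℕ, 0 < b ∧ α = a / b := by
    refine ⟨α.num.toNat, α.den, α.den_pos, ?_⟩
    have : ((α.num.toNat : ℤ) : ℚ) = α.num := by rw [Int.toNat_of_nonneg (Rat.num_nonneg.2 hα)]
    rw [← Int.cast_natCast, this, Rat.num_div_den]
  refine ⟨⟨spoilerInstance PrefList, ?_, not_not.2 ?_, ?_⟩, ?_⟩
  · simp [ControlInstance.OfType, spoilerInstance]
  · rw [isUniqueWinner_copeland hb (by simp [spoilerInstance])]
    simp [spoilerInstance]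
  -- Without voters the contest between `p` and the spoiler is a tie, which gives both the same
  -- score.
  · refine (controllable_copeland_iff hb rfl rfl rfl).2
      ⟨1, by simp [spoilerInstance, ControlInstance.cands], by simp [spoilerInstance],
        by simp [spoilerInstance], ?_⟩
    simp [ControlInstance.Overtakes, ControlInstance.others, spoilerInstance, duel, ahead,
      Finset.filter_singleton]
    omega
  · refine decidableInPolyTime_of_expr (searchExpr (overtakesExpr a b)) fun I => ?_
    exact (val_searchExpr (fun env h h0 h2 => val_overtakesExpr I.1 a b h h0 h2) _).trans
      (controllable_copeland_iff hb (I.2.2.2.1 (by simp)).1 (I.2.2.2.2.1 (by simp))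
        (I.2.2.2.2.2 (by simp))).symm

end Voting

theorem mainTheorem10 :
    (Voting.Vulnerable Voting.plurality .constructive {.AV, .DV, .BV} ∧
      Voting.Vulnerable Voting.plurality .destructive {.AV, .DV, .BV}) ∧
    (Voting.Vulnerable Voting.condorcet .destructive {.AC, .AV, .DV, .BV} ∧
      Voting.Vulnerable Voting.approval .destructive {.AC, .AV, .DV, .BV}) ∧
    (∀ α : ℚ, 0 ≤ α → α ≤ 1 →
      Voting.Vulnerable (Voting.copeland α) .destructive {.AC, .DC}) := by
  exact ⟨⟨Voting.vulnerable_plurality_constructive, Voting.vulnerable_plurality_destructive⟩,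
    ⟨Voting.vulnerable_condorcet _ (by simp), Voting.vulnerable_approval _ (by simp)⟩,
    fun _ hα _ => Voting.vulnerable_copeland hα⟩
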